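/- **Setting.** Let $R$ be a commutative ring and let $S\subseteq R$ be a set of constants with $1\in S$. *Ring operations* are additions, subtractions and multiplications in $R$, counted in straight-line programs over $R$ whose constants are taken from $S$; constants are free of charge. Let $\mathrm{MM}(m,n)$ be such that an $n\times m$ matrix can be multiplied by an $m\times m$ matrix, both over $R$, with at most $\mathrm{MM}(m,n)$ ring operations, and put $\mathrm{MM}(m)=\mathrm{MM}(m,m)$. Let $\mathrm M(d)$ be such that two polynomials of degree at most $d$ over $R$ can be multiplied with at most $\mathrm M(d)$ ring operations; as usual, $\mathrm M$ is assumed superadditive, $\mathrm M(a)+\mathrm M(b)\le \mathrm M(a+b)$ for integers $a,b\ge1$. Write $\mathrm M(\sqrt K)$ for $\mathrm M(\lfloor\sqrt K\rfloor)$. **Theorem.** Let $0<\varepsilon<\tfrac12$. There is a constant $C>0$ depending only on $\varepsilon$ such that the following holds for all $R$, $S$, $\mathrm{MM}$, $\mathrm M$ as above. Let $m\ge1$ and $n\ge0$, let $r, K\ge 0$ and $$0\le K_1<L_1\le K_2<L_2\le\dots\le K_r<L_r\le K$$ be integers with $r<K^{1/2-\varepsilon}$, and let $s=\lfloor\log_4K\rfloor$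 (with $s=0$ if $K=0$). Suppose that $2,3,\dots,2^s+1$ are invertible in $R$ and that their inverses belong to $S$. Consider the $(m+n)\times(m+n)$ matrices $M(x)$ whose entries are polynomials in $R[x]$ of degree at most $1$, of the block lower triangular form $$M(x)=\begin{pmatrix}A&0\\ B&\operatorname{diag}(d_1,\dots,d_n)\end{pmatrix},$$ where $A$ is $m\times m$ and $B$ is $n\times m$. For integers $a<b$ let $M(a,b)=M(b)M(b-1)\cdots M(a+1)$. Then all the interval products $M(K_1,L_1),\dots,M(K_r,L_r)$ can be computed from the coefficients of the entries of $M(x)$, by one straight-line program valid for every such $M(x)$, using at most $$C\left(\bigl(\mathrm{MM}(m)+\mathrm{MM}(m,n)\bigr)\sqrt K+(m^2+mn)\,\mathrm M(\sqrt K)\right)$$ ring operations in $R$. -/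

import Mathlib

open scoped Polynomial

/-! ### Counting ring operations

A problem has a type `Ω` of instances. A quantity depending on the instance is a function `Ω → R`;
a straight-line program is recorded through the list of the quantities that it produces. -/

/-- `IsRingProgram given l`: the list `l` (latest step first) is the list of results of a
straight-line program over `R` that starts from the quantities in `given`. Each step is one
addition, subtraction or multiplication of two quantities that are given or were produced by an
earlier step. The number of ring operations is the length of `l`. -/
inductive IsRingProgram {Ω R : Type*} [CommRing R] (given : Set (Ω → R)) : List (Ω → R) → Prop
  | nil : IsRingProgram given []
  | add {l : List (Ω → R)} {f g : Ω → R} (hl : IsRingProgram given l)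
      (hf : f ∈ given ∨ f ∈ l) (hg : g ∈ given ∨ g ∈ l) : IsRingProgram given ((f + g) :: l)
  | sub {l : List (Ω → R)} {f g : Ω → R} (hl : IsRingProgram given l)
      (hf : f ∈ given ∨ f ∈ l) (hg : g ∈ given ∨ g ∈ l) : IsRingProgram given ((f - g) :: l)
  | mul {l : List (Ω → R)} {f g : Ω → R} (hl : IsRingProgram given l)
      (hf : f ∈ given ∨ f ∈ l) (hg : g ∈ given ∨ g ∈ l) : IsRingProgram given ((f * g) :: l)

/-- All quantities in `out` can be computed from the input quantities `input` and the constants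
in `S` using at most `t` ring operations, by one program that is correct on every instance. -/
def ComputableWithin {Ω R : Type*} [CommRing R] (S : Set R) (input out : Set (Ω → R)) (t : ℝ) :
    Prop :=
  ∃ l : List (Ω → R), IsRingProgram ({f | ∃ c ∈ S, f = fun _ => c} ∪ input) l ∧
    (l.length : ℝ) ≤ t ∧ ∀ f ∈ out, (f ∈ {f | ∃ c ∈ S, f = fun _ => c} ∪ input) ∨ f ∈ l

/-- Over `R`, with constants from `S`, an `n × m` matrix can be multiplied by an `m × m` matrix
using at most `t` ring operations. -/
def MatMulWithin (R : Type*) [CommRing R] (S : Set R) (m n : ℕ) (t : ℝ) : Prop :=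
  ComputableWithin (Ω := Matrix (Fin n) (Fin m) R × Matrix (Fin m) (Fin m) R) S
    ({f | ∃ i j, f = fun P => P.1 i j} ∪ {f | ∃ i j, f = fun P => P.2 i j})
    {f | ∃ i j, f = fun P => (P.1 * P.2) i j} t

/-- Over `R`, with constants from `S`, two polynomials of degree at most `d` can be multiplied
using at most `t` ring operations. -/
def PolyMulWithin (R : Type*) [CommRing R] (S : Set R) (d : ℕ) (t : ℝ) : Prop :=
  ComputableWithin (Ω := {p : R[X] // p.natDegree ≤ d} × {p : R[X] // p.natDegree ≤ d}) S
    ({f | ∃ k ≤ d, f = fun P => P.1.1.coeff k} ∪ {f | ∃ k ≤ d, f = fun P => P.2.1.coeff k})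
    {f | ∃ k ≤ 2 * d, f = fun P => (P.1.1 * P.2.1).coeff k} t

/-! ### Interval products of block lower triangular matrices of linear polynomials -/

/-- `(m + n) × (m + n)` matrices of polynomials of degree at most one, with top right block zero
and diagonal bottom right block. -/
def BlockLinearMatrix (R : Type*) [CommRing R] (m n : ℕ) : Type _ :=
  {M : Matrix (Fin m ⊕ Fin n) (Fin m ⊕ Fin n) R[X] //
    (∀ i j, (M i j).natDegree ≤ 1) ∧ M.toBlocks₁₂ = 0 ∧ M.toBlocks₂₂.IsDiag}

/-- The interval product `M(a, b) = M(b) M(b - 1) ⋯ M(a + 1)` (the identity if `b ≤ a`). -/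
noncomputable def intervalProduct {R ι : Type*} [CommRing R] [Fintype ι] [DecidableEq ι]
    (M : Matrix ι ι R[X]) (a : ℕ) : ℕ → Matrix ι ι R
  | 0 => 1
  | b + 1 =>
    if a ≤ b then M.map (Polynomial.eval ((b + 1 : ℕ) : R)) * intervalProduct M a b else 1

/-- Over `R`, with constants from `S`, the interval products `M(K i, L i)` for all `i` can be
computed from the coefficients of the entries of `M(x)`, for every matrix `M(x)` in
`BlockLinearMatrix R m n`, using at most `t` ring operations. -/
def IntervalProductsWithin (R : Type*) [CommRing R] (S : Set R) (m n : ℕ) {r : ℕ}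
    (K L : Fin r → ℕ) (t : ℝ) : Prop :=
  ComputableWithin (Ω := BlockLinearMatrix R m n) S
    {f | ∃ i j, ∃ k ≤ 1, f = fun M => (M.1 i j).coeff k}
    {f | ∃ q i j, f = fun M => intervalProduct M.1 (K q) (L q) i j} t

/-!
The algorithm is a baby-step giant-step method. For fixed `h` the window product
`M(x + h) ⋯ M(x + 1)` is a matrix whose entries are polynomials of degree at most `h` in `x`
(`exists_polynomial_windowProduct`), so it can be found at new positions from its values at others.

*Full blocks.* Put `s = ⌊log₄ K⌋` and `H = 2 ^ (s - 1)`. Windows of length `2 ^ t` at the positions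
`0, H, 2 H, …, 2 ^ t H` determine, by Lagrange interpolation, those at the positions shifted by
`2 ^ t` and by `(2 ^ t + 1) H`, and products of two such windows are the windows of length
`2 ^ (t + 1)`. A shift of `d + 1` equidistant values costs a single polynomial multiplication
(`calc_eval_shift`), because the Lagrange sum is a convolution with the inverses of the differences
of old and new nodes. These differences are, up to powers of `2`, integers of absolute value at most
`2 ^ s + 1`. The costs double from one level to the next, so that the last level dominates and no
logarithm is lost (`calc_windowsAt_levels`). A bounded number of further shifts gives all blocks of
length `H` up to `K` (`calc_windowsAt_extend`). Since the intervals are disjoint, they contain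
`O(√K)` full blocks in total.

*Initial and final pieces.* What remains are at most `2 r` intervals of length less than `H`, at
arbitrary positions. They are cut into windows of length `2 ^ (s - 1 - g)`, where `g = ⌊ε s⌋`, and
remainders, which are expanded in binary (`calc_windowFns_pieces`). For each length that occurs, the
windows are found by multipoint evaluation (`calc_eval_multipoint`): interpolation gives the
reversed polynomial as the numerator of a sum of fractions, and its values at the points `y j` are
coefficients of its products with the series `1 / (1 - y j * X)`, computed down a product tree. This
loses logarithmic factors, but as `r < K ^ (1/2 - ε)`, both the degrees and the numbers of points
are `O(2 ^ (s - g))`, and the factor `2 ^ g` absorbs the logarithms once `K` is large enough in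
terms of `ε` (`exists_forall_le_two_pow_floor`). For the remaining `K` the matrices are multiplied
one by one.

Linear terms such as the number of scalar operations are paid by lower bounds: over a nontrivial
ring a polynomial multiplication costs at least its degree, and a matrix multiplication at least the
number of entries of the product (`IsPolyMulCost.le_self`, `MatMulWithin.card_le`).
-/


/-! ### Straight-line programs -/

/-- All quantities in `O` can be computed from the quantities in `G` by a straight-line program
with at most `t` ring operations. Unlike in `ComputableWithin`, the constants are part of `G`. -/
def Calc {Ω R : Type*} [CommRing R] (G O : Set (Ω → R)) (t : ℝ) : Prop :=
  ∃ l : List (Ω → R), IsRingProgram G l ∧ (l.length : ℝ) ≤ t ∧ ∀ f ∈ O, f ∈ G ∨ f ∈ l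

section Calc

variable {Ω Ω' R ι : Type*} [CommRing R] {G G' O O' O₁ O₂ : Set (Ω → R)} {t t' t₁ t₂ : ℝ}

theorem IsRingProgram.append {l₁ l₂ : List (Ω → R)} (h₁ : IsRingProgram G l₁)
    (h₂ : IsRingProgram G' l₂) (h : ∀ f ∈ G', f ∈ G ∨ f ∈ l₁) : IsRingProgram G (l₂ ++ l₁) := by
  have key : ∀ {l : List (Ω → R)} {f : Ω → R}, (f ∈ G' ∨ f ∈ l) → f ∈ G ∨ f ∈ l ++ l₁ := by
    intro l f hf
    rcases hf with hf | hf
    · rcases h f hf with h | h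
      · exact .inl h
      · exact .inr (List.mem_append_right _ h)
    · exact .inr (List.mem_append_left _ hf)
  induction h₂ with
  | nil => simpa using h₁
  | add _ hf hg ih => exact .add ih (key hf) (key hg)
  | sub _ hf hg ih => exact .sub ih (key hf) (key hg)
  | mul _ hf hg ih => exact .mul ih (key hf) (key hg)

/-- Programs can be pulled back along a map of instances. -/
theorem IsRingProgram.comp {G : Set (Ω' → R)} {G' : Set (Ω → R)} {l : List (Ω' → R)}
    (hl : IsRingProgram G l) (φ : Ω → Ω') (h : ∀ f ∈ G, f ∘ φ ∈ G') :
    IsRingProgram G' (l.map (· ∘ φ)) := by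
  have key : ∀ {l : List (Ω' → R)} {f : Ω' → R}, (f ∈ G ∨ f ∈ l) →
      f ∘ φ ∈ G' ∨ f ∘ φ ∈ l.map (· ∘ φ) := by
    intro l f hf
    exact hf.imp (h f) (fun hf => List.mem_map_of_mem hf)
  induction hl with
  | nil => exact .nil
  | add _ hf hg ih => exact .add ih (key hf) (key hg)
  | sub _ hf hg ih => exact .sub ih (key hf) (key hg)
  | mul _ hf hg ih => exact .mul ih (key hf) (key hg)

theorem Calc.mono (h : Calc G O t) (hG : G ⊆ G') (hO : O' ⊆ O) (ht : t ≤ t') :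
    Calc G' O' t' := by
  obtain ⟨l, hl, hlt, hlO⟩ := h
  refine ⟨l, ?_, hlt.trans ht, fun f hf => (hlO f (hO hf)).imp (fun h => hG h) id⟩
  simpa using IsRingProgram.append (.nil (given := G')) hl (fun f hf => .inl (hG hf))

theorem Calc.of_subset (h : O ⊆ G) (ht : 0 ≤ t) : Calc G O t :=
  ⟨[], .nil, by simpa using ht, fun _ hf => .inl (h hf)⟩

theorem Calc.nonneg (h : Calc G O t) : 0 ≤ t := by
  obtain ⟨l, -, hl, -⟩ := h
  exact (Nat.cast_nonneg _).trans hl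

/-- Sequential composition of two programs. -/
theorem Calc.bind (h₁ : Calc G O₁ t₁) (h₂ : Calc (G ∪ O₁) O₂ t₂) :
    Calc G (O₁ ∪ O₂) (t₁ + t₂) := by
  obtain ⟨l₁, hl₁, ht₁, hO₁⟩ := h₁
  obtain ⟨l₂, hl₂, ht₂, hO₂⟩ := h₂
  have key : ∀ f ∈ G ∪ O₁, f ∈ G ∨ f ∈ l₁ := by
    rintro f (hf | hf)
    · exact .inl hf
    · exact hO₁ f hf
  refine ⟨l₂ ++ l₁, hl₁.append hl₂ key, ?_, ?_⟩
  · push_cast [List.length_append]; linarith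
  · rintro f (hf | hf)
    · exact (hO₁ f hf).imp id (List.mem_append_right _)
    · rcases hO₂ f hf with h | h
      · exact (key f h).imp id (List.mem_append_right _)
      · exact .inr (List.mem_append_left _ h)

theorem Calc.trans (h₁ : Calc G O₁ t₁) (h₂ : Calc (G ∪ O₁) O₂ t₂) (ht : t₁ + t₂ ≤ t) :
    Calc G O₂ t :=
  (h₁.bind h₂).mono subset_rfl Set.subset_union_right ht

theorem Calc.union (h₁ : Calc G O₁ t₁) (h₂ : Calc G O₂ t₂) : Calc G (O₁ ∪ O₂) (t₁ + t₂) :=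
  h₁.bind (h₂.mono Set.subset_union_left subset_rfl le_rfl)

theorem Calc.biUnion (s : Finset ι) (O : ι → Set (Ω → R)) (T : ι → ℝ)
    (h : ∀ i ∈ s, Calc G (O i) (T i)) : Calc G (⋃ i ∈ s, O i) (∑ i ∈ s, T i) := by
  classical
  induction s using Finset.induction_on with
  | empty => exact .of_subset (by simp) (by simp)
  | insert a s ha ih =>
    rw [Finset.set_biUnion_insert, Finset.sum_insert ha]
    exact (h a (by simp)).union (ih fun i hi => h i (by simp [hi]))

theorem Calc.biUnion_const (s : Finset ι) (O : ι → Set (Ω → R))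
    (h : ∀ i ∈ s, Calc G (O i) t) : Calc G (⋃ i ∈ s, O i) (s.card * t) := by
  simpa using Calc.biUnion s O (fun _ => t) h

/-- Finitely many quantities, each computed by the same number of operations. -/
theorem Calc.family (s : Finset ι) (F : ι → Ω → R) (h : ∀ i ∈ s, Calc G {F i} t) :
    Calc G (F '' s) (s.card * t) := by
  refine (Calc.biUnion_const s (fun i => {F i}) h).mono subset_rfl ?_ le_rfl
  rintro _ ⟨i, hi, rfl⟩
  simp only [Set.mem_iUnion, Set.mem_singleton_iff]
  exact ⟨i, hi, rfl⟩

/-- Quantities produced one batch after the other, each batch from the preceding one. -/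
theorem Calc.seq (F : ℕ → Set (Ω → R)) (N : ℕ) (T : ℕ → ℝ) (h0 : Calc G (F 0) t)
    (h : ∀ k < N, Calc (G ∪ F k) (F (k + 1)) (T k)) :
    Calc G (⋃ k ∈ Finset.range (N + 1), F k) (t + ∑ k ∈ Finset.range N, T k) := by
  induction N with
  | zero => simpa using h0
  | succ N ih =>
    have ih := ih fun k hk => h k (hk.trans (Nat.lt_succ_self N))
    rw [Finset.sum_range_succ, ← add_assoc, Finset.range_add_one, Finset.set_biUnion_insert,
      Set.union_comm]
    refine ih.bind ((h N (Nat.lt_succ_self N)).mono ?_ subset_rfl le_rfl)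
    refine Set.union_subset_union_right _ ?_
    exact Set.subset_biUnion_of_mem (u := F) (by simp)

theorem Calc.var {f : Ω → R} (hf : f ∈ G) : Calc G {f} 0 :=
  .of_subset (by simpa using hf) le_rfl

theorem Calc.add {f g : Ω → R} (hf : Calc G {f} t₁) (hg : Calc G {g} t₂) :
    Calc G {f + g} (t₁ + t₂ + 1) :=
  (hf.union hg).trans ⟨_, .add .nil (.inl (.inr (.inl rfl))) (.inl (.inr (.inr rfl))), by simp,
    by simp⟩ le_rfl

theorem Calc.sub {f g : Ω → R} (hf : Calc G {f} t₁) (hg : Calc G {g} t₂) :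
    Calc G {f - g} (t₁ + t₂ + 1) :=
  (hf.union hg).trans ⟨_, .sub .nil (.inl (.inr (.inl rfl))) (.inl (.inr (.inr rfl))), by simp,
    by simp⟩ le_rfl

theorem Calc.mul {f g : Ω → R} (hf : Calc G {f} t₁) (hg : Calc G {g} t₂) :
    Calc G {f * g} (t₁ + t₂ + 1) :=
  (hf.union hg).trans ⟨_, .mul .nil (.inl (.inr (.inl rfl))) (.inl (.inr (.inr rfl))), by simp,
    by simp⟩ le_rfl

/-- A program for one problem solves every problem that is reduced to it by a map of instances. -/
theorem Calc.comp {G : Set (Ω' → R)} {O : Set (Ω' → R)} (h : Calc G O t) (φ : Ω → Ω')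
    {G' : Set (Ω → R)} (hG : ∀ f ∈ G, f ∘ φ ∈ G') : Calc G' ((· ∘ φ) '' O) t := by
  obtain ⟨l, hl, ht, hO⟩ := h
  refine ⟨_, hl.comp φ hG, by simpa using ht, ?_⟩
  rintro _ ⟨f, hf, rfl⟩
  exact (hO f hf).imp (hG f) (fun hf => List.mem_map_of_mem hf)

/-- Quantities that are pairwise different and not given cost at least one operation each. -/
theorem Calc.card_le [Fintype ι] (h : Calc G O t) (F : ι → Ω → R)
    (hF : Function.Injective F) (hO : ∀ i, F i ∈ O) (hG : ∀ i, F i ∉ G) :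
    (Fintype.card ι : ℝ) ≤ t := by
  classical
  obtain ⟨l, -, ht, hl⟩ := h
  refine le_trans ?_ ht
  have : (Finset.univ.image F).card ≤ l.toFinset.card := Finset.card_le_card (by
    intro f hf
    obtain ⟨i, -, rfl⟩ := Finset.mem_image.1 hf
    exact List.mem_toFinset.2 ((hl _ (hO i)).resolve_left (hG i)))
  rw [Finset.card_image_of_injective _ hF, Finset.card_univ] at this
  exact_mod_cast this.trans l.toFinset_card_le

/-- Partial products of given quantities. -/
theorem Calc.prod_range (c : ℕ → Ω → R) (N : ℕ) (h1 : 1 ∈ G) (hc : ∀ k < N, c k ∈ G) :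
    Calc G ((fun k => ∏ j ∈ Finset.range k, c j) '' Finset.range (N + 1)) N := by
  have := Calc.seq (G := G) (fun k => {∏ j ∈ Finset.range k, c j}) N (fun _ => 1) (t := 0)
    (.var (by simpa using h1)) (fun k hk => by
      rw [Finset.prod_range_succ]
      exact (Calc.mul (.var (.inr rfl)) (.var (.inl (hc k hk)))).mono subset_rfl subset_rfl
        (by norm_num))
  refine this.mono subset_rfl ?_ (by simp)
  rintro _ ⟨k, hk, rfl⟩
  simp only [Set.mem_iUnion]
  exact ⟨k, hk, rfl⟩

end Calc

/-! ### Programs for polynomial arithmetic -/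

/-- What a cost function `M` for polynomial multiplication provides over a nontrivial ring. -/
structure IsPolyMulCost (R : Type*) [CommRing R] (S : Set R) (M : ℕ → ℝ) : Prop where
  one_mem : (1 : R) ∈ S
  within : ∀ d, PolyMulWithin R S d (M d)
  superadd : ∀ a b : ℕ, 1 ≤ a → 1 ≤ b → M a + M b ≤ M (a + b)
  one_le : 1 ≤ M 1

/-- The given quantities `G` include zero and the constants from `S`. -/
structure HasConsts {Ω R : Type*} [CommRing R] (S : Set R) (G : Set (Ω → R)) : Prop where
  const_mem : ∀ c ∈ S, (fun _ => c) ∈ G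
  zero_mem : 0 ∈ G

theorem HasConsts.mono {Ω R : Type*} [CommRing R] {S : Set R} {G G' : Set (Ω → R)}
    (h : HasConsts S G) (hG : G ⊆ G') : HasConsts S G' :=
  ⟨fun c hc => hG (h.const_mem c hc), hG h.zero_mem⟩

theorem HasConsts.union {Ω R : Type*} [CommRing R] {S : Set R} {G O : Set (Ω → R)}
    (h : HasConsts S G) : HasConsts S (G ∪ O) :=
  h.mono Set.subset_union_left

namespace IsPolyMulCost

variable {R : Type*} [CommRing R] {S : Set R} {M : ℕ → ℝ}

theorem nonneg (h : IsPolyMulCost R S M) (d : ℕ) : 0 ≤ M d :=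
  Calc.nonneg (h.within d)

theorem mono (h : IsPolyMulCost R S M) {a b : ℕ} (ha : 1 ≤ a) (hab : a ≤ b) : M a ≤ M b := by
  rcases hab.eq_or_lt with rfl | hab
  · exact le_rfl
  · have := h.superadd a (b - a) ha (by omega)
    rw [Nat.add_sub_cancel' hab.le] at this
    linarith [h.nonneg (b - a)]

theorem mul_le (h : IsPolyMulCost R S M) {k a : ℕ} (hk : 1 ≤ k) (ha : 1 ≤ a) :
    (k : ℝ) * M a ≤ M (k * a) := by
  induction k, hk using Nat.le_induction with
  | base => simp
  | succ k hk ih =>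
    have := h.superadd (k * a) a (Nat.mul_pos hk ha) ha
    push_cast
    rw [add_mul, add_mul, one_mul, one_mul]
    linarith

theorem le_self (h : IsPolyMulCost R S M) {d : ℕ} (hd : 1 ≤ d) : (d : ℝ) ≤ M d := by
  have := h.mul_le hd le_rfl
  rw [mul_one] at this
  nlinarith [h.one_le, (Nat.cast_nonneg d : (0 : ℝ) ≤ d)]

theorem two_mul_le (h : IsPolyMulCost R S M) (b : ℕ) : 2 * M (2 ^ b) ≤ M (2 ^ (b + 1)) := by
  have := h.mul_le (k := 2) (a := 2 ^ b) (by norm_num) Nat.one_le_two_pow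
  rw [pow_succ, mul_comm (2 ^ b)]
  exact_mod_cast this

end IsPolyMulCost

/-- Over a nontrivial ring the product of two linear polynomials costs at least one operation. -/
theorem PolyMulWithin.one_le {R : Type*} [CommRing R] [Nontrivial R] {S : Set R} {t : ℝ}
    (h : PolyMulWithin R S 1 t) : 1 ≤ t := by
  have := Calc.card_le (ι := Unit) h (fun _ P => (P.1.1 * P.2.1).coeff 0)
    (fun _ _ _ => rfl) (fun _ => ⟨0, by norm_num, rfl⟩) (fun _ hmem => ?_)
  · simpa using this
  · rcases hmem with ⟨c, -, hc⟩ | ⟨k, hk, hc⟩ | ⟨k, hk, hc⟩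
    · have h0 := congrFun hc (⟨0, by simp⟩, ⟨0, by simp⟩)
      have h1 := congrFun hc (⟨1, by simp⟩, ⟨1, by simp⟩)
      simp only [mul_zero, Polynomial.coeff_zero, mul_one, Polynomial.coeff_one_zero] at h0 h1
      exact zero_ne_one (h0.trans h1.symm)
    · have h0 := congrFun hc (⟨Polynomial.X ^ k, (Polynomial.natDegree_X_pow_le k).trans hk⟩,
        ⟨0, by simp⟩)
      simp at h0
    · have h0 := congrFun hc (⟨0, by simp⟩,
        ⟨Polynomial.X ^ k, (Polynomial.natDegree_X_pow_le k).trans hk⟩)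
      simp at h0

/-- The polynomial of degree less than `n` formed by the coefficients `i, …, i + n - 1` of `p`. -/
noncomputable def Polynomial.slice {R : Type*} [Semiring R] (p : R[X]) (i n : ℕ) : R[X] :=
  ∑ k ∈ Finset.range n, Polynomial.monomial k (p.coeff (i + k))

theorem Polynomial.coeff_slice {R : Type*} [Semiring R] (p : R[X]) (i n k : ℕ) :
    (p.slice i n).coeff k = if k < n then p.coeff (i + k) else 0 := by
  simp [Polynomial.slice, Polynomial.finsetSum_coeff, Polynomial.coeff_monomial]

theorem Polynomial.natDegree_slice_le {R : Type*} [Semiring R] (p : R[X]) (i n : ℕ) :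
    (p.slice i n).natDegree ≤ n - 1 := by
  rw [Polynomial.natDegree_le_iff_coeff_eq_zero]
  intro k hk
  rw [Polynomial.coeff_slice, if_neg (by omega)]

/-- The coefficients of a polynomial depending on the instance, as quantities. -/
def coeffFns {Ω R : Type*} [CommRing R] (p : Ω → R[X]) : Set (Ω → R) :=
  Set.range fun k ω => (p ω).coeff k

section PolyCalc

variable {Ω R : Type*} [CommRing R] {S : Set R} {G : Set (Ω → R)} {p q : Ω → R[X]} {t : ℝ}
  {M : ℕ → ℝ}

theorem coeffFns_subset (D : ℕ) (hp : ∀ ω, (p ω).natDegree ≤ D) {O : Set (Ω → R)}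
    (hO : 0 ∈ O) (h : ∀ k ≤ D, (fun ω => (p ω).coeff k) ∈ O) : coeffFns p ⊆ O := by
  rintro _ ⟨k, rfl⟩
  by_cases hk : k ≤ D
  · exact h k hk
  · convert hO using 1
    funext ω
    exact Polynomial.coeff_eq_zero_of_natDegree_lt ((hp ω).trans_lt (not_le.1 hk))

/-- The coefficients of a polynomial, from those up to a bound of its degree. -/
theorem Calc.coeffFns_of_le (h0 : 0 ∈ G) (D : ℕ) (hp : ∀ ω, (p ω).natDegree ≤ D)
    (h : Calc G ((fun k ω => (p ω).coeff k) '' Finset.range (D + 1)) t) :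
    Calc G (coeffFns p) t := by
  refine (h.trans (t₂ := 0) (.of_subset ?_ le_rfl) (by simp))
  refine coeffFns_subset D hp (.inl h0) fun k hk => .inr ⟨k, ?_, rfl⟩
  simpa [Nat.lt_succ_iff] using hk

theorem Calc.coeffFns_mul {D : ℕ} (hM : PolyMulWithin R S D t) (hG : HasConsts S G)
    (hp : ∀ ω, (p ω).natDegree ≤ D) (hq : ∀ ω, (q ω).natDegree ≤ D)
    (hpG : coeffFns p ⊆ G) (hqG : coeffFns q ⊆ G) :
    Calc G (coeffFns fun ω => p ω * q ω) t := by
  refine Calc.coeffFns_of_le hG.zero_mem (2 * D) (fun ω => ?_) ?_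
  · exact Polynomial.natDegree_mul_le.trans (by linarith [hp ω, hq ω])
  · refine (Calc.comp hM (fun ω => (⟨p ω, hp ω⟩, ⟨q ω, hq ω⟩)) (G' := G) ?_).mono subset_rfl ?_
      le_rfl
    · rintro _ (⟨c, hc, rfl⟩ | ⟨k, hk, rfl⟩ | ⟨k, hk, rfl⟩)
      · exact hG.const_mem c hc
      · exact hpG ⟨k, rfl⟩
      · exact hqG ⟨k, rfl⟩
    · rintro _ ⟨k, hk, rfl⟩
      refine ⟨_, ⟨k, ?_, rfl⟩, rfl⟩
      simpa [Nat.lt_succ_iff] using hk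

theorem Calc.coeffFns_add {D : ℕ} (h0 : 0 ∈ G)
    (hp : ∀ ω, (p ω).natDegree ≤ D) (hq : ∀ ω, (q ω).natDegree ≤ D)
    (hpG : coeffFns p ⊆ G) (hqG : coeffFns q ⊆ G) :
    Calc G (coeffFns fun ω => p ω + q ω) (D + 1) := by
  refine Calc.coeffFns_of_le h0 D (fun ω => Polynomial.natDegree_add_le_of_degree_le (hp ω) (hq ω))
    ?_
  refine (Calc.family (t := 1) (Finset.range (D + 1)) _ fun k _ => ?_).mono subset_rfl subset_rfl
    (by simp)
  convert (Calc.var (hpG ⟨k, rfl⟩)).add (Calc.var (hqG ⟨k, rfl⟩)) using 1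
  · ext; simp [funext_iff]
  · norm_num

theorem Calc.coeffFns_sub {D : ℕ} (h0 : 0 ∈ G)
    (hp : ∀ ω, (p ω).natDegree ≤ D) (hq : ∀ ω, (q ω).natDegree ≤ D)
    (hpG : coeffFns p ⊆ G) (hqG : coeffFns q ⊆ G) :
    Calc G (coeffFns fun ω => p ω - q ω) (D + 1) := by
  refine Calc.coeffFns_of_le h0 D (fun ω => Polynomial.natDegree_sub_le_of_le (hp ω) (hq ω) |>.trans
    (by simp)) ?_
  refine (Calc.family (t := 1) (Finset.range (D + 1)) _ fun k _ => ?_).mono subset_rfl subset_rfl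
    (by simp)
  convert (Calc.var (hpG ⟨k, rfl⟩)).sub (Calc.var (hqG ⟨k, rfl⟩)) using 1
  · ext; simp [funext_iff]
  · norm_num

theorem coeffFns_slice_subset (h0 : 0 ∈ G) (h : coeffFns p ⊆ G) (i n : ℕ) :
    coeffFns (fun ω => (p ω).slice i n) ⊆ G := by
  rintro _ ⟨k, rfl⟩
  simp only [Polynomial.coeff_slice]
  split_ifs with hk
  · exact h ⟨_, rfl⟩
  · exact h0

theorem coeffFns_X_pow_mul_subset (h0 : 0 ∈ G) (h : coeffFns p ⊆ G) (i : ℕ) :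
    coeffFns (fun ω => Polynomial.X ^ i * p ω) ⊆ G := by
  rintro _ ⟨k, rfl⟩
  simp only [Polynomial.coeff_X_pow_mul']
  split_ifs with hk
  · exact h ⟨_, rfl⟩
  · exact h0

/-- The polynomial `∏ (1 - x l * X)` over `l ∈ s`. Unlike in `∏ (X - x l)`, a node `x l = 0`
contributes the factor `1`, so that families of nodes can be padded. -/
noncomputable def revProd {R : Type*} [CommRing R] (s : Finset ℕ) (x : ℕ → R) : R[X] :=
  ∏ l ∈ s, (1 - Polynomial.C (x l) * Polynomial.X)

theorem natDegree_one_sub_C_mul_X_le (c : R) :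
    (1 - Polynomial.C c * Polynomial.X).natDegree ≤ 1 := by
  compute_degree

theorem natDegree_revProd_le (s : Finset ℕ) (x : ℕ → R) : (revProd s x).natDegree ≤ s.card := by
  refine (Polynomial.natDegree_prod_le _ _).trans ?_
  refine (Finset.sum_le_card_nsmul _ _ 1 fun l _ => natDegree_one_sub_C_mul_X_le _).trans ?_
  simp

theorem revProd_range_add (h k : ℕ) (x : ℕ → R) :
    revProd (Finset.range (h + k)) x =
      revProd (Finset.range h) x * revProd (Finset.range k) fun l => x (h + l) :=
  Finset.prod_range_add _ _ _

/-- The product is computed by halving; each level costs at most `M (2 ^ b)` by superadditivity. -/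
theorem calc_revProd (hM : IsPolyMulCost R S M) (b : ℕ) {G : Set (Ω → R)} (hG : HasConsts S G)
    (x : ℕ → Ω → R) (hx : ∀ l < 2 ^ b, x l ∈ G) :
    Calc G (coeffFns fun ω => revProd (Finset.range (2 ^ b)) fun l => x l ω)
      ((b + 1) * M (2 ^ b)) := by
  induction b generalizing x with
  | zero =>
    refine Calc.coeffFns_of_le hG.zero_mem 1
      (fun ω => (natDegree_revProd_le _ _).trans (by simp)) ?_
    have h1 : Calc G {0 - x 0} 1 :=
      ((Calc.var hG.zero_mem).sub (Calc.var (hx 0 (by simp)))).mono subset_rfl subset_rfl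
        (by norm_num)
    refine (h1.trans (t₂ := 0) (.of_subset ?_ le_rfl) le_rfl).mono subset_rfl subset_rfl
      (by simpa using hM.one_le)
    rintro _ ⟨k, hk, rfl⟩
    have hk : k < 2 := by simpa using hk
    interval_cases k
    · left
      convert hG.const_mem 1 hM.one_mem using 2
      simp [revProd]
    · right
      refine Set.mem_singleton_iff.2 (funext fun ω => ?_)
      simp [revProd, Polynomial.coeff_one]
  | succ b ih =>
    have e : (2 : ℕ) ^ (b + 1) = 2 ^ b + 2 ^ b := by ring
    have hl := ih x fun l hl => hx l (by omega)
    have hr := ih (fun l => x (2 ^ b + l)) fun l hl => hx _ (by omega)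
    refine (hl.union hr).trans (t₂ := M (2 ^ b)) ?_ ?_
    · simp only [e, revProd_range_add]
      refine Calc.coeffFns_mul (hM.within _) hG.union ?_ ?_ ?_ ?_
      · intro ω; simpa using natDegree_revProd_le (Finset.range (2 ^ b)) fun l => x l ω
      · intro ω; simpa using natDegree_revProd_le (Finset.range (2 ^ b)) fun l => x (2 ^ b + l) ω
      · exact Set.subset_union_left.trans Set.subset_union_right
      · exact Set.subset_union_right.trans Set.subset_union_right
    · have := hM.two_mul_le b
      have h2 := hM.nonneg (2 ^ b)
      push_cast
      nlinarith [(Nat.cast_nonneg b : (0 : ℝ) ≤ b)]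

end PolyCalc

/-! ### Lagrange interpolation over a commutative ring -/

section Lagrange

variable {R : Type*} [CommRing R]

/-- A polynomial of degree at most `d` with `d + 1` zeros whose differences are units vanishes,
over any commutative ring: the coprime factors `X - x l` all divide it. -/
theorem Polynomial.eq_zero_of_eval_eq_zero_of_isUnit_sub (p : R[X]) (d : ℕ)
    (hp : p.natDegree ≤ d) (x : ℕ → R)
    (hx : ∀ i ≤ d, ∀ j ≤ d, i ≠ j → IsUnit (x i - x j))
    (h : ∀ i ≤ d, p.eval (x i) = 0) : p = 0 := by
  nontriviality R
  have hdvd : ∏ l ∈ Finset.range (d + 1), (Polynomial.X - Polynomial.C (x l)) ∣ p := by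
    refine Finset.prod_dvd_of_coprime ?_ ?_
    · intro i hi j hj hij
      simp only [Finset.coe_range, Set.mem_Iio, Nat.lt_succ_iff] at hi hj
      exact Polynomial.isCoprime_X_sub_C_of_isUnit_sub (hx i hi j hj hij)
    · intro i hi
      exact Polynomial.dvd_iff_isRoot.2 (h i (by simpa [Nat.lt_succ_iff] using hi))
  by_contra hne
  have hm : (∏ l ∈ Finset.range (d + 1), (Polynomial.X - Polynomial.C (x l))).Monic :=
    Polynomial.monic_prod_of_monic _ _ fun l _ => Polynomial.monic_X_sub_C _
  have hdeg : (∏ l ∈ Finset.range (d + 1), (Polynomial.X - Polynomial.C (x l))).natDegree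
      = d + 1 := by
    rw [Polynomial.natDegree_prod_of_monic _ _ fun l _ => Polynomial.monic_X_sub_C _]
    simp
  obtain ⟨q, rfl⟩ := hdvd
  have hq : q ≠ 0 := by rintro rfl; simp at hne
  rw [hm.natDegree_mul' hq, hdeg] at hp
  omega

/-- `1 / i!`, as the product of the inverses of `1, …, i` (meaningful if these are units). -/
noncomputable def invFactorial (R : Type*) [CommRing R] (i : ℕ) : R :=
  ∏ j ∈ Finset.range i, Ring.inverse ((j + 1 : ℕ) : R)

/-- The weight `(-1) ^ (d - i) / (i! (d - i)!)` of the node `i` in Lagrange interpolation at the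
nodes `0, …, d`. -/
noncomputable def lagrangeWeight (R : Type*) [CommRing R] (d i : ℕ) : R :=
  (-1) ^ (d - i) * (invFactorial R i * invFactorial R (d - i))

theorem prod_range_sub_self (i : ℕ) :
    ∏ l ∈ Finset.range i, ((i : R) - l) = ∏ j ∈ Finset.range i, ((j + 1 : ℕ) : R) := by
  rw [← Finset.prod_range_reflect]
  refine Finset.prod_congr rfl fun j hj => ?_
  have hj : j < i := by simpa using hj
  rw [show i - 1 - j = i - (j + 1) by omega, Nat.cast_sub (by omega)]
  push_cast
  ring

theorem prod_erase_sub (d i : ℕ) (hi : i ≤ d) :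
    ∏ l ∈ (Finset.range (d + 1)).erase i, ((i : R) - l) =
      (-1) ^ (d - i) * ((∏ j ∈ Finset.range i, ((j + 1 : ℕ) : R)) *
        ∏ j ∈ Finset.range (d - i), ((j + 1 : ℕ) : R)) := by
  obtain ⟨k, rfl⟩ := Nat.exists_eq_add_of_le hi
  rw [show i + k - i = k by omega]
  induction k with
  | zero =>
    rw [add_zero, Finset.range_add_one, Finset.erase_insert (by simp), prod_range_sub_self]
    simp
  | succ k ih =>
    rw [← add_assoc, Finset.range_add_one, Finset.erase_insert_of_ne (by omega),
      Finset.prod_insert (by simp), ih (by omega), Finset.prod_range_succ _ k]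
    push_cast
    ring

theorem prod_mul_invFactorial (i : ℕ) (h : ∀ j, 1 ≤ j → j ≤ i → IsUnit (j : R)) :
    (∏ j ∈ Finset.range i, ((j + 1 : ℕ) : R)) * invFactorial R i = 1 := by
  rw [invFactorial, ← Finset.prod_mul_distrib]
  refine Finset.prod_eq_one fun j hj => Ring.mul_inverse_cancel _ (h _ (by omega) ?_)
  simpa using hj

theorem prod_erase_mul_lagrangeWeight (d i : ℕ) (hi : i ≤ d)
    (h : ∀ j, 1 ≤ j → j ≤ d → IsUnit (j : R)) :
    (∏ l ∈ (Finset.range (d + 1)).erase i, ((i : R) - l)) * lagrangeWeight R d i = 1 := by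
  rw [prod_erase_sub d i hi, lagrangeWeight]
  have h1 := prod_mul_invFactorial i fun j hj hji => h j hj (hji.trans hi)
  have h2 := prod_mul_invFactorial (d - i) fun j hj hji => h j hj (by omega)
  have h3 : ((-1 : R) ^ (d - i)) * (-1) ^ (d - i) = 1 := by rw [← mul_pow]; simp
  linear_combination ((-1 : R) ^ (d - i)) * (-1) ^ (d - i) *
    ((∏ j ∈ Finset.range (d - i), ((j + 1 : ℕ) : R)) * invFactorial R (d - i)) * h1
    + ((-1 : R) ^ (d - i)) * (-1) ^ (d - i) * h2 + h3

theorem isUnit_cast_sub_cast {d : ℕ} (h : ∀ j, 1 ≤ j → j ≤ d → IsUnit (j : R)) {i j : ℕ}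
    (hi : i ≤ d) (hj : j ≤ d) (hij : i ≠ j) : IsUnit ((i : R) - j) := by
  rcases lt_or_gt_of_ne hij with hlt | hlt
  · rw [← neg_sub, IsUnit.neg_iff, ← Nat.cast_sub hlt.le]
    exact h _ (by omega) (by omega)
  · rw [← Nat.cast_sub hlt.le]
    exact h _ (by omega) (by omega)

/-- Lagrange interpolation at `0, …, d` over a commutative ring in which these are units. -/
theorem Polynomial.eq_lagrange (p : R[X]) (d : ℕ) (hp : p.natDegree ≤ d)
    (h : ∀ j, 1 ≤ j → j ≤ d → IsUnit (j : R)) :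
    p = ∑ i ∈ Finset.range (d + 1), Polynomial.C (p.eval (i : R) * lagrangeWeight R d i) *
      ∏ l ∈ (Finset.range (d + 1)).erase i, (Polynomial.X - Polynomial.C (l : R)) := by
  rw [← sub_eq_zero]
  refine Polynomial.eq_zero_of_eval_eq_zero_of_isUnit_sub _ d ?_ (fun i => (i : R))
    (fun i hi j hj hij => isUnit_cast_sub_cast h hi hj hij) ?_
  · refine (Polynomial.natDegree_sub_le_of_le hp ?_).trans_eq (max_self d)
    refine Polynomial.natDegree_sum_le_of_forall_le _ _ fun i hi => ?_
    refine (Polynomial.natDegree_C_mul_le _ _).trans ?_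
    refine (Polynomial.natDegree_prod_le _ _).trans ?_
    refine (Finset.sum_le_card_nsmul _ _ 1 fun l _ => Polynomial.natDegree_X_sub_C_le _).trans ?_
    rw [Finset.card_erase_of_mem hi]
    simp
  · intro i hi
    rw [Polynomial.eval_sub, Polynomial.eval_finsetSum, Finset.sum_eq_single i]
    · rw [Polynomial.eval_mul, Polynomial.eval_C, Polynomial.eval_prod]
      simp only [Polynomial.eval_sub, Polynomial.eval_X, Polynomial.eval_C]
      linear_combination (-p.eval (i : R)) * prod_erase_mul_lagrangeWeight d i hi h
    · intro j _ hji
      rw [Polynomial.eval_mul, Polynomial.eval_prod,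
        Finset.prod_eq_zero (i := i) (by simp [hji.symm, hi]) (by simp), mul_zero]
    · intro hni
      exact absurd (Finset.mem_range.2 (Nat.lt_succ_of_le hi)) hni

/-- Evaluation at the shifted nodes `k + a`, as a sliding product times a convolution. -/
theorem Polynomial.eval_shift_eq (p : R[X]) (d : ℕ) (hp : p.natDegree ≤ d)
    (h : ∀ j, 1 ≤ j → j ≤ d → IsUnit (j : R)) (a : R) (c : ℕ → R)
    (hc : ∀ j ≤ 2 * d, (a + j - d) * c j = 1) (k : ℕ) (hk : k ≤ d) :
    p.eval (k + a) = (∏ j ∈ Finset.range (d + 1), (a + (k + j : ℕ) - d)) *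
      ((∑ i ∈ Finset.range (d + 1), Polynomial.monomial i (p.eval (i : R) * lagrangeWeight R d i)) *
        ∑ j ∈ Finset.range (2 * d + 1), Polynomial.monomial j (c j)).coeff (d + k) := by
  have hprod : (∏ j ∈ Finset.range (d + 1), (a + (k + j : ℕ) - d)) =
      ∏ l ∈ Finset.range (d + 1), ((k : R) + a - l) := by
    rw [← Finset.prod_range_reflect]
    refine Finset.prod_congr rfl fun j hj => ?_
    have hj : j ≤ d := by simpa [Nat.lt_succ_iff] using hj
    rw [show d + 1 - 1 - j = d - j by omega, Nat.cast_add, Nat.cast_sub hj]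
    ring
  conv_lhs => rw [p.eq_lagrange d hp h]
  rw [Polynomial.eval_finsetSum, hprod, Finset.sum_mul, Polynomial.finsetSum_coeff,
    Finset.mul_sum]
  refine Finset.sum_congr rfl fun i hi => ?_
  have hi' : i ≤ d := by simpa [Nat.lt_succ_iff] using hi
  rw [Polynomial.eval_mul, Polynomial.eval_C, Polynomial.eval_prod]
  simp only [Polynomial.eval_sub, Polynomial.eval_X, Polynomial.eval_C]
  rw [← Polynomial.C_mul_X_pow_eq_monomial, mul_assoc (Polynomial.C _), Polynomial.coeff_C_mul,
    Polynomial.coeff_X_pow_mul', if_pos (by omega), Polynomial.finsetSum_coeff,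
    ← Finset.mul_prod_erase _ _ hi, Finset.sum_eq_single (d + k - i)]
  · rw [Polynomial.coeff_monomial, if_pos rfl]
    have := hc (d + k - i) (by omega)
    rw [Nat.cast_sub (by omega)] at this
    push_cast at this
    linear_combination (-p.eval (i : R) * lagrangeWeight R d i *
      ∏ l ∈ (Finset.range (d + 1)).erase i, ((k : R) + a - l)) * this
  · intro j _ hj
    rw [Polynomial.coeff_monomial, if_neg hj]
  · intro hn
    exact absurd (Finset.mem_range.2 (by omega)) hn

end Lagrange

/-! ### Shifting the values on an arithmetic progression -/

section Shift

variable {Ω R : Type*} [CommRing R] {S : Set R} {G : Set (Ω → R)} {M : ℕ → ℝ}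

/-- The numbers `1, …, d` are units of `R` whose inverses are given. -/
def HasInverses (G : Set (Ω → R)) (d : ℕ) : Prop :=
  ∀ j : ℕ, 1 ≤ j → j ≤ d → IsUnit (j : R) ∧ (fun _ => Ring.inverse (j : R)) ∈ G

theorem HasInverses.mono {G' : Set (Ω → R)} {d d' : ℕ} (h : HasInverses G d) (hG : G ⊆ G')
    (hd : d' ≤ d) : HasInverses G' d' :=
  fun j hj hjd => ⟨(h j hj (hjd.trans hd)).1, hG (h j hj (hjd.trans hd)).2⟩

/-- The values of a polynomial at `0, …, d`, multiplied by the Lagrange weights. -/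
theorem calc_eval_mul_lagrangeWeight (hM : IsPolyMulCost R S M) (hG : HasConsts S G) {d : ℕ}
    (hinv : HasInverses G d) (p : Ω → R[X]) (hpG : ∀ i ≤ d, (fun ω => (p ω).eval (i : R)) ∈ G) :
    Calc G ((fun (i : ℕ) ω => (p ω).eval (i : R) * lagrangeWeight R d i) ''
      Finset.range (d + 1)) (4 * d + 3) := by
  have h1 := Calc.prod_range (G := G) (fun j _ => Ring.inverse ((j + 1 : ℕ) : R)) d
    (hG.const_mem 1 hM.one_mem) (fun k hk => (hinv (k + 1) (by omega) hk).2)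
  refine h1.trans (Calc.family (t := 3) _ _ fun i hi => ?_)
    (by push_cast [Finset.card_range]; linarith)
  have hi : i ≤ d := by simpa [Nat.lt_succ_iff] using hi
  have hf : ∀ k ≤ d, Calc (G ∪ (fun k => ∏ j ∈ Finset.range k,
      (fun _ : Ω => Ring.inverse ((j + 1 : ℕ) : R))) '' Finset.range (d + 1))
      {fun _ => invFactorial R k} 0 := by
    intro k hk
    refine .var (.inr ⟨k, by simpa [Nat.lt_succ_iff] using hk, ?_⟩)
    ext ω
    simp [invFactorial]
  have h2 := (Calc.var (.inl (hpG i hi))).mul ((hf i hi).mul (hf (d - i) (by omega)))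
  rcases Nat.even_or_odd (d - i) with he | ho
  · refine h2.mono subset_rfl ?_ (by norm_num)
    rintro _ rfl
    ext ω
    simp [lagrangeWeight, he.neg_one_pow]
  · refine ((Calc.var (.inl hG.zero_mem)).sub h2).mono subset_rfl ?_ (by norm_num)
    rintro _ rfl
    ext ω
    simp [lagrangeWeight, ho.neg_one_pow]

/-- From the values of a polynomial of degree at most `d` at `0, …, d`, its values at
`a, …, d + a`, at the cost of one polynomial multiplication up to a constant factor. -/
theorem calc_eval_shift (hM : IsPolyMulCost R S M) (hG : HasConsts S G) {d : ℕ} (hd : 1 ≤ d)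
    (hinv : HasInverses G d) (p : Ω → R[X]) (hp : ∀ ω, (p ω).natDegree ≤ d)
    (hpG : ∀ i ≤ d, (fun ω => (p ω).eval (i : R)) ∈ G) (a : R) (c : ℕ → R)
    (hc : ∀ j ≤ 2 * d, (a + j - d) * c j = 1)
    (haG : ∀ j ≤ 2 * d, (fun _ => a + j - d) ∈ G) (hcG : ∀ j ≤ 2 * d, (fun _ => c j) ∈ G) :
    Calc G ((fun (k : ℕ) ω => (p ω).eval (k + a)) '' Finset.range (d + 1)) (8 * M (2 * d)) := by
  have hle := hM.le_self (d := 2 * d) (by omega)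
  have hd' : (1 : ℝ) ≤ d := by exact_mod_cast hd
  push_cast at hle
  set F : Ω → R[X] := fun ω => ∑ i ∈ Finset.range (d + 1),
    Polynomial.monomial i ((p ω).eval (i : R) * lagrangeWeight R d i) with hF
  set Q : Ω → R[X] := fun _ => ∑ j ∈ Finset.range (2 * d + 1), Polynomial.monomial j (c j) with hQ
  have hFdeg : ∀ ω, (F ω).natDegree ≤ d := fun ω =>
    Polynomial.natDegree_sum_le_of_forall_le _ _ fun i hi =>
      (Polynomial.natDegree_monomial_le _).trans (by simpa [Nat.lt_succ_iff] using hi)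
  have hQdeg : ∀ ω, (Q ω).natDegree ≤ 2 * d := fun ω =>
    Polynomial.natDegree_sum_le_of_forall_le _ _ fun i hi =>
      (Polynomial.natDegree_monomial_le _).trans (by simpa [Nat.lt_succ_iff] using hi)
  set Δ : ℕ → Ω → R := fun k _ => ∏ j ∈ Finset.range (d + 1), (a + (k + j : ℕ) - d) with hΔ
  -- the convolution
  have hconv : Calc G (coeffFns fun ω => F ω * Q ω) (4 * d + 3 + M (2 * d)) := by
    refine (calc_eval_mul_lagrangeWeight hM hG hinv p hpG).trans
      (Calc.coeffFns_mul (hM.within _) hG.union (fun ω => (hFdeg ω).trans (by omega)) hQdeg ?_ ?_)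
      le_rfl
    · refine coeffFns_subset d hFdeg (.inl hG.zero_mem) fun k hk =>
        .inr ⟨k, by simpa [Nat.lt_succ_iff] using hk, ?_⟩
      ext ω
      simp [hF, Polynomial.finsetSum_coeff, Polynomial.coeff_monomial, hk]
    · refine coeffFns_subset _ hQdeg (.inl hG.zero_mem) fun k hk => .inl ?_
      convert hcG k hk using 1
      ext ω
      simp [hQ, Polynomial.finsetSum_coeff, Polynomial.coeff_monomial, hk]
  -- the sliding product: one multiplication by the new factor, one by the inverse of the old one
  have hΔ0 : Calc G {Δ 0} (d + 1) := by
    refine (Calc.prod_range (fun j _ => a + j - d) (d + 1) (hG.const_mem 1 hM.one_mem)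
      fun k hk => haG k (by omega)).mono subset_rfl ?_ (by push_cast; rfl)
    rintro _ rfl
    refine ⟨d + 1, by simp, ?_⟩
    ext ω
    simp [hΔ]
  have hΔs : Calc G (⋃ k ∈ Finset.range (d + 1), {Δ k}) ((d + 1) + 2 * d) := by
    refine (Calc.seq (fun k => {Δ k}) d (fun _ => 2) hΔ0 fun k hk => ?_).mono subset_rfl subset_rfl
      (by simp [mul_comm])
    refine (((Calc.var (.inr rfl)).mul (Calc.var (.inl (haG (k + d + 1) (by omega))))).mul
      (Calc.var (.inl (hcG k (by omega))))).mono subset_rfl ?_ (by norm_num)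
    rintro _ rfl
    ext ω
    have h1 : (∏ j ∈ Finset.range (d + 2), (a + (k + j : ℕ) - d)) =
        (a + k - d) * ∏ j ∈ Finset.range (d + 1), (a + (k + 1 + j : ℕ) - d) := by
      rw [Finset.prod_range_succ', mul_comm]
      simp only [add_zero]
      congr 1
      refine Finset.prod_congr rfl fun j _ => ?_
      rw [show k + (j + 1) = k + 1 + j by ring]
    rw [Finset.prod_range_succ] at h1
    simp only [hΔ, Pi.mul_apply]
    have h2 := hc k (by omega)
    rw [show k + d + 1 = k + (d + 1) by ring, h1]
    linear_combination (-∏ j ∈ Finset.range (d + 1), (a + (k + 1 + j : ℕ) - d)) * h2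
  refine (hconv.union hΔs).trans (Calc.family (t := 1) _ _ fun k hk => ?_)
    (by push_cast [Finset.card_range]; nlinarith)
  have hk : k ≤ d := by simpa [Nat.lt_succ_iff] using hk
  have h1 : Δ k ∈ G ∪ (coeffFns (fun ω => F ω * Q ω) ∪ ⋃ k ∈ Finset.range (d + 1), {Δ k}) := by
    refine .inr (.inr ?_)
    simp only [Set.mem_iUnion]
    exact ⟨k, by simpa [Nat.lt_succ_iff] using hk, rfl⟩
  refine ((Calc.var h1).mul (Calc.var (.inr (.inl ⟨d + k, rfl⟩)))).mono subset_rfl ?_ (by norm_num)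
  rintro _ rfl
  ext ω
  exact Polynomial.eval_shift_eq (p ω) d (hp ω) (fun j hj hjd => (hinv j hj hjd).1) a c hc k hk

end Shift

/-! ### Product trees and power series inversion -/

section Interpolation

variable {Ω R : Type*} [CommRing R] {S : Set R} {G : Set (Ω → R)} {M : ℕ → ℝ}

theorem revProd_erase_left (h k j : ℕ) (hj : j < h) (x : ℕ → R) :
    revProd ((Finset.range (h + k)).erase j) x =
      revProd ((Finset.range h).erase j) x * revProd (Finset.range k) fun l => x (h + l) := by
  induction k with
  | zero => simp [revProd]
  | succ k ih =>
    rw [← add_assoc, Finset.range_add_one, Finset.erase_insert_of_ne (by omega), revProd,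
      Finset.prod_insert (by simp), ← revProd, ih, revProd, revProd, revProd,
      Finset.prod_range_succ]
    ring

theorem revProd_erase_right (h k j : ℕ) (hj : j < k) (x : ℕ → R) :
    revProd ((Finset.range (h + k)).erase (h + j)) x =
      revProd (Finset.range h) x * revProd ((Finset.range k).erase j) fun l => x (h + l) := by
  induction k with
  | zero => omega
  | succ k ih =>
    rw [← add_assoc, Finset.range_add_one (n := h + k), Finset.range_add_one (n := k)]
    rcases (Nat.lt_succ_iff.1 hj).eq_or_lt with rfl | hjk
    · rw [Finset.erase_insert (by simp), Finset.erase_insert (by simp), revProd_range_add]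
    · rw [Finset.erase_insert_of_ne (by omega), Finset.erase_insert_of_ne (by omega), revProd,
        Finset.prod_insert (by simp), ← revProd, ih hjk, revProd, revProd, revProd,
        Finset.prod_insert (by simp)]
      ring

/-- The numerator `∑ f j * ∏ (1 - x l * X)` (sum over `j < n`, product over `l < n` with `l ≠ j`)
of the sum of the fractions `f j / (1 - x j * X)`. -/
noncomputable def revNum (n : ℕ) (x f : ℕ → R) : R[X] :=
  ∑ j ∈ Finset.range n, Polynomial.C (f j) * revProd ((Finset.range n).erase j) x

theorem natDegree_revProd_erase_le (n j : ℕ) (hj : j < n) (x : ℕ → R) :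
    (revProd ((Finset.range n).erase j) x).natDegree ≤ n - 1 := by
  refine (natDegree_revProd_le _ _).trans ?_
  rw [Finset.card_erase_of_mem (by simpa using hj), Finset.card_range]

theorem natDegree_revNum_le (n : ℕ) (x f : ℕ → R) : (revNum n x f).natDegree ≤ n - 1 :=
  Polynomial.natDegree_sum_le_of_forall_le _ _ fun j hj =>
    (Polynomial.natDegree_C_mul_le _ _).trans
      (natDegree_revProd_erase_le n j (by simpa using hj) x)

theorem revNum_add (h k : ℕ) (x f : ℕ → R) :
    revNum (h + k) x f =
      revNum h x f * (revProd (Finset.range k) fun l => x (h + l)) +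
      revProd (Finset.range h) x * revNum k (fun l => x (h + l)) fun l => f (h + l) := by
  rw [revNum, Finset.sum_range_add, revNum, revNum, Finset.sum_mul, Finset.mul_sum]
  refine congrArg₂ (· + ·) ?_ ?_
  · refine Finset.sum_congr rfl fun j hj => ?_
    rw [revProd_erase_left h k j (by simpa using hj), mul_assoc]
  · refine Finset.sum_congr rfl fun j hj => ?_
    rw [revProd_erase_right h k j (by simpa using hj), mul_left_comm]

/-- The numerator is computed by halving, together with the denominators of both halves. These are
recomputed at each level, which is why the logarithm is squared. -/
theorem calc_revNum (hM : IsPolyMulCost R S M) (b : ℕ) (hG : HasConsts S G)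
    (x f : ℕ → Ω → R) (hx : ∀ l < 2 ^ b, x l ∈ G) (hf : ∀ l < 2 ^ b, f l ∈ G) :
    Calc G (coeffFns fun ω => revNum (2 ^ b) (fun l => x l ω) fun l => f l ω)
      ((b + 2) ^ 2 * M (2 ^ b)) := by
  induction b generalizing x f with
  | zero =>
    refine .of_subset ?_ (mul_nonneg (by positivity) (hM.nonneg _))
    refine coeffFns_subset 0 (fun ω => natDegree_revNum_le _ _ _) hG.zero_mem fun k hk => ?_
    obtain rfl : k = 0 := by omega
    convert hf 0 (by simp) using 1
    ext ω
    simp [revNum, revProd]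
  | succ b ih =>
    have e : (2 : ℕ) ^ (b + 1) = 2 ^ b + 2 ^ b := by ring
    have hpos : 1 ≤ 2 ^ b := Nat.one_le_two_pow
    have hl := ih x f (fun l hl => hx l (by omega)) fun l hl => hf l (by omega)
    have hr := ih (fun l => x (2 ^ b + l)) (fun l => f (2 ^ b + l))
      (fun l hl => hx _ (by omega)) fun l hl => hf _ (by omega)
    have hpl := calc_revProd hM b hG x fun l hl => hx l (by omega)
    have hpr := calc_revProd hM b hG (fun l => x (2 ^ b + l)) fun l hl => hx _ (by omega)
    have hdeg : ∀ x : ℕ → R, (revProd (Finset.range (2 ^ b)) x).natDegree ≤ 2 ^ b := fun x => by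
      simpa using natDegree_revProd_le (Finset.range (2 ^ b)) x
    have hdeg' : ∀ x f : ℕ → R, (revNum (2 ^ b) x f).natDegree ≤ 2 ^ b - 1 := fun x f =>
      natDegree_revNum_le _ _ _
    simp only [e, revNum_add]
    set P : Ω → R[X] := fun ω => revProd (Finset.range (2 ^ b)) fun l => x l ω
    set Q : Ω → R[X] := fun ω => revProd (Finset.range (2 ^ b)) fun l => x (2 ^ b + l) ω
    set A : Ω → R[X] := fun ω => revNum (2 ^ b) (fun l => x l ω) fun l => f l ω
    set B : Ω → R[X] := fun ω =>
      revNum (2 ^ b) (fun l => x (2 ^ b + l) ω) fun l => f (2 ^ b + l) ω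
    have hmul := ((hl.union hr).union (hpl.union hpr)).trans
      (O₂ := (coeffFns fun ω => A ω * Q ω) ∪ coeffFns fun ω => P ω * B ω) (Calc.union
      (Calc.coeffFns_mul (hM.within (2 ^ b)) hG.union (fun ω => (hdeg' _ _).trans (by omega))
        (fun ω => hdeg _)
        (Set.subset_union_left.trans (Set.subset_union_left.trans Set.subset_union_right))
        (Set.subset_union_right.trans (Set.subset_union_right.trans Set.subset_union_right)))
      (Calc.coeffFns_mul (hM.within (2 ^ b)) hG.union (fun ω => hdeg _)
        (fun ω => (hdeg' _ _).trans (by omega))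
        (Set.subset_union_left.trans (Set.subset_union_right.trans Set.subset_union_right))
        (Set.subset_union_right.trans (Set.subset_union_left.trans Set.subset_union_right))))
      le_rfl
    refine hmul.trans (Calc.coeffFns_add (D := 2 * 2 ^ b - 1) hG.union.zero_mem ?_ ?_
      (Set.subset_union_left.trans Set.subset_union_right)
      (Set.subset_union_right.trans Set.subset_union_right)) ?_
    · intro ω
      exact Polynomial.natDegree_mul_le.trans
        ((Nat.add_le_add (hdeg' _ _) (hdeg _)).trans (by omega))
    · intro ω
      exact Polynomial.natDegree_mul_le.trans
        ((Nat.add_le_add (hdeg _) (hdeg' _ _)).trans (by omega))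
    · have h1 := hM.two_mul_le b
      rw [e] at h1
      have h2 := hM.nonneg (2 ^ b)
      have h3 := hM.le_self hpos
      rw [Nat.cast_sub (by omega)]
      push_cast at h3 ⊢
      nlinarith [(Nat.cast_nonneg b : (0 : ℝ) ≤ b), sq_nonneg (b : ℝ)]

end Interpolation

section Evaluation

variable {Ω R : Type*} [CommRing R] {S : Set R} {G : Set (Ω → R)} {M : ℕ → ℝ}

/-- Only a window of `n` coefficients of `B` contributes. -/
theorem Polynomial.coeff_mul_slice (A B : R[X]) (n : ℕ) (hn : 1 ≤ n) (hA : A.natDegree ≤ n - 1) :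
    (A * B).coeff (n + n - 1) = (A * B.slice n n).coeff (n - 1) := by
  rw [Polynomial.coeff_mul, Polynomial.coeff_mul,
    Finset.Nat.sum_antidiagonal_eq_sum_range_succ_mk,
    Finset.Nat.sum_antidiagonal_eq_sum_range_succ_mk,
    show (n + n - 1).succ = n + n by omega, show (n - 1).succ = n by omega, Finset.sum_range_add]
  rw [Finset.sum_eq_zero (s := Finset.range n) (f := fun x => A.coeff (n + x) * _), add_zero]
  · refine Finset.sum_congr rfl fun k hk => ?_
    have hk : k < n := by simpa using hk
    rw [Polynomial.coeff_slice, if_pos (by omega), show n + (n - 1 - k) = n + n - 1 - k by omega]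
  · intro k _
    rw [Polynomial.coeff_eq_zero_of_natDegree_lt (by omega), zero_mul]

/-- Descent in the product tree, the transpose of the computation of `revNum`. A node with `n`
leaves carries the window `H` of `n` coefficients, ending at a fixed index, of a power series
`F / ∏ (1 - y l * X)`. Multiplication by the product over the other half of the leaves gives the
series of a child, of which half as many coefficients are kept; at the leaf `j` the last
coefficient of `F / (1 - y j * X)` remains. -/
theorem calc_coeff_revProd_erase_mul (hM : IsPolyMulCost R S M) (b : ℕ) (hG : HasConsts S G)
    (y : ℕ → Ω → R) (hy : ∀ l < 2 ^ b, y l ∈ G) (H : Ω → R[X])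
    (hH : ∀ ω, (H ω).natDegree ≤ 2 ^ b - 1) (hHG : coeffFns H ⊆ G) :
    Calc G ((fun j ω => (revProd ((Finset.range (2 ^ b)).erase j) (fun l => y l ω) * H ω).coeff
      (2 ^ b - 1)) '' Finset.range (2 ^ b)) ((b + 2) ^ 2 * M (2 ^ b)) := by
  induction b generalizing y H G with
  | zero =>
    refine .of_subset ?_ (mul_nonneg (by positivity) (hM.nonneg _))
    rintro _ ⟨j, hj, rfl⟩
    obtain rfl : j = 0 := by simpa using hj
    convert hHG ⟨0, rfl⟩ using 1
    ext ω
    simp [revProd]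
  | succ b ih =>
    have e : (2 : ℕ) ^ (b + 1) = 2 ^ b + 2 ^ b := by ring
    have hpos : 1 ≤ 2 ^ b := Nat.one_le_two_pow
    have hpl := calc_revProd hM b hG y fun l hl => hy l (by omega)
    have hpr := calc_revProd hM b hG (fun l => y (2 ^ b + l)) fun l hl => hy _ (by omega)
    have hdeg : ∀ x : ℕ → R, (revProd (Finset.range (2 ^ b)) x).natDegree ≤ 2 ^ (b + 1) :=
      fun x => (natDegree_revProd_le (Finset.range (2 ^ b)) x).trans (by simp [e])
    set L : Ω → R[X] := fun ω => revProd (Finset.range (2 ^ b)) fun l => y l ω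
    set Q : Ω → R[X] := fun ω => revProd (Finset.range (2 ^ b)) fun l => y (2 ^ b + l) ω
    have hml := (hpl.union hpr).trans (O₂ := (coeffFns fun ω => Q ω * H ω) ∪
      (coeffFns fun ω => L ω * H ω)) (Calc.union
      (Calc.coeffFns_mul (hM.within (2 ^ (b + 1))) hG.union (fun ω => hdeg _)
        (fun ω => (hH ω).trans (by omega)) (Set.subset_union_right.trans Set.subset_union_right)
        (hHG.trans Set.subset_union_left))
      (Calc.coeffFns_mul (hM.within (2 ^ (b + 1))) hG.union (fun ω => hdeg _)
        (fun ω => (hH ω).trans (by omega)) (Set.subset_union_left.trans Set.subset_union_right)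
        (hHG.trans Set.subset_union_left))) le_rfl
    refine hml.trans (Calc.mono (Calc.union
      (ih hG.union y (fun l hl => .inl (hy l (by omega)))
        (fun ω => (Q ω * H ω).slice (2 ^ b) (2 ^ b)) (fun ω => Polynomial.natDegree_slice_le _ _ _)
        ?_)
      (ih hG.union (fun l => y (2 ^ b + l)) (fun l hl => .inl (hy _ (by omega)))
        (fun ω => (L ω * H ω).slice (2 ^ b) (2 ^ b)) (fun ω => Polynomial.natDegree_slice_le _ _ _)
        ?_)) subset_rfl ?_ le_rfl) ?_
    · exact coeffFns_slice_subset (.inl hG.zero_mem)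
        (Set.subset_union_left.trans Set.subset_union_right) _ _
    · exact coeffFns_slice_subset (.inl hG.zero_mem)
        (Set.subset_union_right.trans Set.subset_union_right) _ _
    · rintro _ ⟨j, hj, rfl⟩
      have hj : j < 2 ^ b + 2 ^ b := by simpa [e] using hj
      by_cases hjb : j < 2 ^ b
      · refine .inl ⟨j, by simpa using hjb, ?_⟩
        ext ω
        simp only [e]
        rw [revProd_erase_left _ _ _ hjb, mul_assoc,
          Polynomial.coeff_mul_slice _ _ _ hpos (natDegree_revProd_erase_le _ _ hjb _)]
      · obtain ⟨i, rfl⟩ := Nat.exists_eq_add_of_le (not_lt.1 hjb)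
        have hi : i < 2 ^ b := by omega
        refine .inr ⟨i, by simpa using hi, ?_⟩
        ext ω
        simp only [e]
        rw [revProd_erase_right _ _ _ hi, mul_assoc, mul_left_comm,
          Polynomial.coeff_mul_slice _ _ _ hpos (natDegree_revProd_erase_le _ _ hi _)]
    · have h1 := hM.two_mul_le b
      have h2 := hM.nonneg (2 ^ b)
      push_cast
      nlinarith [(Nat.cast_nonneg b : (0 : ℝ) ≤ b), sq_nonneg (b : ℝ)]

theorem Polynomial.X_pow_dvd_sub_slice (p : R[X]) (n : ℕ) :
    Polynomial.X ^ n ∣ p - p.slice 0 n := by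
  rw [Polynomial.X_pow_dvd_iff]
  intro k hk
  simp [Polynomial.coeff_slice, hk]

/-- Newton iteration for the inverse of `D` as a power series, truncated at degree `n`. -/
noncomputable def newtonInv (n : ℕ) (D : R[X]) : ℕ → R[X]
  | 0 => 1
  | k + 1 => (newtonInv n D k +
      newtonInv n D k * (1 - (D * newtonInv n D k).slice 0 n)).slice 0 n

theorem natDegree_newtonInv_le (n : ℕ) (D : R[X]) (k : ℕ) :
    (newtonInv n D k).natDegree ≤ n - 1 := by
  cases k with
  | zero => simp [newtonInv]
  | succ k => exact Polynomial.natDegree_slice_le _ _ _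

/-- Each step of the Newton iteration squares the error. -/
theorem X_pow_dvd_one_sub_mul_newtonInv (n : ℕ) (D : R[X]) (hD : D.coeff 0 = 1) (k : ℕ)
    (hk : 2 ^ k ≤ n) : Polynomial.X ^ 2 ^ k ∣ 1 - D * newtonInv n D k := by
  induction k with
  | zero =>
    rw [Polynomial.X_pow_dvd_iff]
    intro j hj
    obtain rfl : j = 0 := by simpa using hj
    simp [newtonInv, hD]
  | succ k ih =>
    set g := newtonInv n D k
    have ih : Polynomial.X ^ 2 ^ k ∣ 1 - D * g := ih ((Nat.pow_le_pow_right (by norm_num)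
      (Nat.le_succ k)).trans hk)
    have h1 : Polynomial.X ^ 2 ^ (k + 1) ∣ D * g - (D * g).slice 0 n :=
      (pow_dvd_pow _ hk).trans (Polynomial.X_pow_dvd_sub_slice _ _)
    have h2 : Polynomial.X ^ 2 ^ (k + 1) ∣ (1 - D * g) * (1 - D * g) := by
      rw [pow_succ, mul_two, pow_add]
      exact mul_dvd_mul ih ih
    have h3 : Polynomial.X ^ 2 ^ (k + 1) ∣ (g + g * (1 - (D * g).slice 0 n)) -
        (g + g * (1 - (D * g).slice 0 n)).slice 0 n :=
      (pow_dvd_pow _ hk).trans (Polynomial.X_pow_dvd_sub_slice _ _)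
    have : 1 - D * newtonInv n D (k + 1) = (1 - D * g) * (1 - D * g)
        - D * g * (D * g - (D * g).slice 0 n)
        + D * ((g + g * (1 - (D * g).slice 0 n)) -
          (g + g * (1 - (D * g).slice 0 n)).slice 0 n) := by
      rw [newtonInv]; ring
    rw [this]
    exact dvd_add (dvd_sub h2 (h1.mul_left _)) (h3.mul_left _)

theorem calc_newtonInv (hM : IsPolyMulCost R S M) {n : ℕ} (hn : 1 ≤ n) (hG : HasConsts S G)
    (D : Ω → R[X]) (hD : ∀ ω, (D ω).natDegree ≤ n) (hDG : coeffFns D ⊆ G) (k : ℕ) :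
    Calc G (coeffFns fun ω => newtonInv n (D ω) k) (4 * k * M n) := by
  induction k with
  | zero =>
    refine .of_subset ?_ (by simp)
    refine coeffFns_subset 0 (fun ω => by simp [newtonInv]) hG.zero_mem fun k hk => ?_
    obtain rfl : k = 0 := by omega
    simpa [newtonInv] using hG.const_mem 1 hM.one_mem
  | succ k ih =>
    set g : Ω → R[X] := fun ω => newtonInv n (D ω) k
    have hg : ∀ ω, (g ω).natDegree ≤ n - 1 := fun ω => natDegree_newtonInv_le _ _ _
    have hs : ∀ p : R[X], (p.slice 0 n).natDegree ≤ n - 1 := fun p =>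
      Polynomial.natDegree_slice_le _ _ _
    have h1 : Calc (G ∪ coeffFns g) (coeffFns fun ω => D ω * g ω) (M n) :=
      Calc.coeffFns_mul (hM.within n) hG.union hD (fun ω => (hg ω).trans (by omega))
        (hDG.trans Set.subset_union_left) Set.subset_union_right
    set G₁ := G ∪ coeffFns g
    have hG₁ : HasConsts S G₁ := hG.union
    have hd1 : ∀ ω, (1 - (D ω * g ω).slice 0 n).natDegree ≤ n - 1 := fun ω =>
      (Polynomial.natDegree_sub_le_of_le (m := 0) (by simp) (hs _)).trans (by simp)
    have h2 : Calc G₁ (coeffFns fun ω => 1 - (D ω * g ω).slice 0 n) (M n + n) := by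
      refine h1.trans (Calc.coeffFns_sub (D := n - 1) hG₁.union.zero_mem (fun ω => by simp)
        (fun ω => hs _) ?_ (coeffFns_slice_subset hG₁.union.zero_mem Set.subset_union_right _ _)) ?_
      · refine coeffFns_subset 0 (fun ω => by simp) hG₁.union.zero_mem fun k hk => ?_
        obtain rfl : k = 0 := by omega
        simpa using hG₁.union.const_mem 1 hM.one_mem
      · rw [Nat.cast_sub hn]; simp
    have h3 : Calc G₁ (coeffFns fun ω => g ω * (1 - (D ω * g ω).slice 0 n)) (M n + n + M n) :=
      h2.trans (Calc.coeffFns_mul (hM.within n) hG₁.union (fun ω => (hg ω).trans (by omega))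
        (fun ω => (hd1 ω).trans (by omega))
        (Set.subset_union_right.trans Set.subset_union_left) Set.subset_union_right) le_rfl
    -- only the first `n` coefficients of the last sum are needed
    have h4 : Calc G₁ (coeffFns fun ω => newtonInv n (D ω) (k + 1)) (M n + n + M n + n) := by
      refine h3.trans (Calc.coeffFns_of_le hG₁.union.zero_mem (n - 1)
        (fun ω => natDegree_newtonInv_le _ _ _) (t := n) ?_) le_rfl
      refine (Calc.family (t := 1) (Finset.range (n - 1 + 1)) _ fun j hj => ?_).mono subset_rfl
        subset_rfl (by rw [Nat.sub_add_cancel hn]; simp)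
      have hj : j < n := by simpa [Nat.sub_add_cancel hn] using hj
      refine ((Calc.var (.inl (.inr ⟨j, rfl⟩))).add (Calc.var (.inr ⟨j, rfl⟩))).mono subset_rfl ?_
        (by norm_num)
      rintro _ rfl
      ext ω
      simp [newtonInv, Polynomial.coeff_slice, hj, g]
    refine ih.trans h4 ?_
    have := hM.le_self hn
    push_cast
    linarith

end Evaluation

/-! ### Multipoint evaluation -/

section Multipoint

variable {Ω R : Type*} [CommRing R] {S : Set R} {G : Set (Ω → R)} {M : ℕ → ℝ}

theorem reflect_revProd (s : Finset ℕ) (x : ℕ → R) :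
    (revProd s x).reflect s.card = ∏ l ∈ s, (Polynomial.X - Polynomial.C (x l)) := by
  classical
  induction s using Finset.induction_on with
  | empty => simp [revProd, Polynomial.reflect_one]
  | insert a s ha ih =>
    rw [revProd, Finset.prod_insert ha, ← revProd, Finset.card_insert_of_notMem ha,
      add_comm s.card, Polynomial.reflect_mul _ _ (natDegree_one_sub_C_mul_X_le _)
      (natDegree_revProd_le _ _), ih, Finset.prod_insert ha]
    congr 1
    simp [Polynomial.reflect_one]

/-- With the nodes `0, …, d`, padded by zeros, and the values of `p` times the Lagrange weights as
numerators, `revNum` is the reversal of `p`. -/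
theorem revNum_eq_reflect (p : R[X]) (d n : ℕ) (hp : p.natDegree ≤ d) (hdn : d < n)
    (h : ∀ j, 1 ≤ j → j ≤ d → IsUnit (j : R)) (x f : ℕ → R) (hx : ∀ l ≤ d, x l = l)
    (hx0 : ∀ l, d < l → x l = 0) (hf : ∀ l ≤ d, f l = p.eval (l : R) * lagrangeWeight R d l)
    (hf0 : ∀ l, d < l → f l = 0) : revNum n x f = p.reflect d := by
  have h1 : revNum n x f = revNum (d + 1) x f := by
    obtain ⟨k, rfl⟩ := Nat.exists_eq_add_of_le (Nat.succ_le_of_lt hdn)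
    have h2 : revNum k (fun l => x (d.succ + l)) (fun l => f (d.succ + l)) = 0 :=
      Finset.sum_eq_zero fun j _ => by beta_reduce; rw [hf0 _ (by omega), Polynomial.C_0, zero_mul]
    have h3 : revProd (Finset.range k) (fun l => x (d.succ + l)) = 1 :=
      Finset.prod_eq_one fun j _ => by
        beta_reduce; rw [hx0 _ (by omega), Polynomial.C_0, zero_mul, sub_zero]
    rw [revNum_add, h2, h3, mul_zero, mul_one, add_zero]
  have key : (revNum (d + 1) x f).reflect d = p := by
    conv_rhs => rw [p.eq_lagrange d hp h]
    have hsum : ∀ (s : Finset ℕ) (g : ℕ → R[X]),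
        (∑ j ∈ s, g j).reflect d = ∑ j ∈ s, (g j).reflect d := fun s g => by
      ext k; simp [Polynomial.finsetSum_coeff]
    rw [revNum, hsum]
    refine Finset.sum_congr rfl fun j hj => ?_
    have hjd : j ≤ d := by simpa [Nat.lt_succ_iff] using hj
    have hc : ((Finset.range (d + 1)).erase j).card = d := by
      rw [Finset.card_erase_of_mem hj, Finset.card_range, Nat.add_sub_cancel]
    have h4 := reflect_revProd ((Finset.range (d + 1)).erase j) x
    rw [hc] at h4
    rw [Polynomial.reflect_C_mul, h4, hf j hjd]
    congr 1
    refine Finset.prod_congr rfl fun l hl => ?_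
    rw [hx l (by simpa [Nat.lt_succ_iff] using Finset.mem_of_mem_erase hl)]
  rw [h1, ← key]
  ext k
  simp

/-- The value of `p` at `y` is a coefficient of the reversal of `p` times the geometric series. -/
theorem coeff_reflect_mul_geom (p : R[X]) (d : ℕ) (hp : p.natDegree ≤ d) (n : ℕ) (hdn : d < n)
    (y : R) : (p.reflect d * ∑ k ∈ Finset.range n, Polynomial.monomial k (y ^ k)).coeff d =
      p.eval y := by
  rw [Polynomial.coeff_mul, Finset.Nat.sum_antidiagonal_eq_sum_range_succ_mk,
    Polynomial.eval_eq_sum_range' (Nat.lt_succ_of_le hp), ← Finset.sum_range_reflect]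
  refine Finset.sum_congr rfl fun k hk => ?_
  have hk : k ≤ d := by simpa [Nat.lt_succ_iff] using hk
  rw [Polynomial.coeff_reflect, show d.succ - 1 - k = d - k by omega,
    Polynomial.revAt_le (Nat.sub_le d k), Nat.sub_sub_self hk, Polynomial.finsetSum_coeff,
    Finset.sum_eq_single k]
  · simp
  · intro j _ hj
    rw [Polynomial.coeff_monomial, if_neg hj]
  · intro hn
    exact absurd (Finset.mem_range.2 (by omega)) hn

/-- If the root of the product tree is the reversal of `p`, multiplied by a power of `X` and by the
inverse `I` of the product of all factors, then the leaves carry the values of `p`. -/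
theorem coeff_revProd_erase_mul_eq_eval (p : R[X]) (d n : ℕ) (hp : p.natDegree ≤ d) (hdn : d < n)
    (y : ℕ → R) (I : R[X])
    (hI : Polynomial.X ^ n ∣ 1 - revProd (Finset.range n) y * I) (j : ℕ) (hj : j < n) :
    (revProd ((Finset.range n).erase j) y *
      (Polynomial.X ^ (n - 1 - d) * (p.reflect d * I)).slice 0 n).coeff (n - 1) =
      p.eval (y j) := by
  set E := revProd ((Finset.range n).erase j) y
  set g : R[X] := ∑ k ∈ Finset.range n, Polynomial.monomial k (y j ^ k)
  set Q := Polynomial.X ^ (n - 1 - d) * (p.reflect d * I)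
  have hD : revProd (Finset.range n) y = (1 - Polynomial.C (y j) * Polynomial.X) * E :=
    (Finset.mul_prod_erase _ _ (Finset.mem_range.2 hj)).symm
  have hg : (1 - Polynomial.C (y j) * Polynomial.X) * g =
      1 - (Polynomial.C (y j) * Polynomial.X) ^ n := by
    have : g = ∑ k ∈ Finset.range n, (Polynomial.C (y j) * Polynomial.X) ^ k :=
      Finset.sum_congr rfl fun k _ => by
        rw [← Polynomial.C_mul_X_pow_eq_monomial, mul_pow, Polynomial.C_pow]
    rw [this]
    exact mul_neg_geom_sum _ n
  have h1 : Polynomial.X ^ n ∣ E * I - g := by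
    have h2 : E * I - g = (1 - revProd (Finset.range n) y * I) * (-g) +
        Polynomial.X ^ n * (Polynomial.C (y j) ^ n * (E * I)) := by
      rw [hD]
      linear_combination (-(E * I)) * hg
    rw [h2]
    exact dvd_add (hI.mul_right _) (dvd_mul_right _ _)
  have h3 : Polynomial.X ^ n ∣ E * Q.slice 0 n -
      Polynomial.X ^ (n - 1 - d) * (p.reflect d * g) := by
    have h4 : E * Q.slice 0 n - Polynomial.X ^ (n - 1 - d) * (p.reflect d * g) =
        -E * (Q - Q.slice 0 n) + Polynomial.X ^ (n - 1 - d) * p.reflect d * (E * I - g) := by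
      simp only [Q]; ring
    rw [h4]
    exact dvd_add ((Polynomial.X_pow_dvd_sub_slice Q n).mul_left _) (h1.mul_left _)
  have h5 := Polynomial.X_pow_dvd_iff.1 h3 (n - 1) (by omega)
  rw [Polynomial.coeff_sub, sub_eq_zero] at h5
  rw [h5, Polynomial.coeff_X_pow_mul', if_pos (by omega),
    show n - 1 - (n - 1 - d) = d by omega, coeff_reflect_mul_geom p d hp n hdn]

/-- Multipoint evaluation: from the values of a polynomial of degree at most `d < 2 ^ a` at
`0, …, d`, its values at any `2 ^ a` given points, in quasi-linear time. -/
theorem calc_eval_multipoint (hM : IsPolyMulCost R S M) (hG : HasConsts S G) {d a : ℕ}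
    (hda : d < 2 ^ a) (hinv : HasInverses G d)
    (hnat : ∀ i ≤ d, (fun _ => (i : R)) ∈ G) (p : Ω → R[X])
    (hp : ∀ ω, (p ω).natDegree ≤ d) (hpG : ∀ i ≤ d, (fun ω => (p ω).eval (i : R)) ∈ G)
    (y : ℕ → R) (hy : ∀ j < 2 ^ a, (fun _ => y j) ∈ G) :
    Calc G ((fun j ω => (p ω).eval (y j)) '' Finset.range (2 ^ a))
      (4 * (a + 2) ^ 2 * M (2 ^ a)) := by
  have hpos : 1 ≤ 2 ^ a := Nat.one_le_two_pow
  set x : ℕ → Ω → R := fun l _ => if l ≤ d then (l : R) else 0 with hx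
  set f : ℕ → Ω → R := fun l ω => if l ≤ d then (p ω).eval (l : R) * lagrangeWeight R d l else 0
    with hf
  have hrev : ∀ ω, revNum (2 ^ a) (fun l => x l ω) (fun l => f l ω) = (p ω).reflect d := fun ω =>
    revNum_eq_reflect (p ω) d (2 ^ a) (hp ω) hda (fun j hj hjd => (hinv j hj hjd).1) _ _
      (fun l hl => by simp [hx, hl]) (fun l hl => by simp [hx, not_le.2 hl])
      (fun l hl => by simp [hf, hl]) (fun l hl => by simp [hf, not_le.2 hl])
  set D : Ω → R[X] := fun _ => revProd (Finset.range (2 ^ a)) y with hD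
  have hDdeg : ∀ ω, (D ω).natDegree ≤ 2 ^ a := fun ω => by
    simpa using natDegree_revProd_le (Finset.range (2 ^ a)) y
  have hrefl : ∀ ω, ((p ω).reflect d).natDegree ≤ d := fun ω =>
    Polynomial.natDegree_reflect_le.trans (max_le le_rfl (hp ω))
  have hnum : Calc G (coeffFns fun ω => (p ω).reflect d)
      (4 * d + 3 + (a + 2) ^ 2 * M (2 ^ a)) := by
    simp only [← hrev]
    refine (calc_eval_mul_lagrangeWeight hM hG hinv p hpG).trans
      (calc_revNum hM a hG.union x f (fun l _ => ?_) (fun l _ => ?_)) le_rfl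
    · by_cases hl : l ≤ d
      · simpa [hx, hl] using Or.inl (hnat l hl)
      · simp only [hx, hl, if_false]
        exact .inl hG.zero_mem
    · by_cases hl : l ≤ d
      · simp only [hf, hl, if_true]
        exact .inr ⟨l, by simpa [Nat.lt_succ_iff] using hl, rfl⟩
      · simp only [hf, hl, if_false]
        exact .inl hG.zero_mem
  set I : Ω → R[X] := fun ω => newtonInv (2 ^ a) (D ω) a
  have hI : Calc G (coeffFns I) ((a + 1) * M (2 ^ a) + 4 * a * M (2 ^ a)) :=
    (calc_revProd hM a hG (fun l _ => y l) hy).trans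
      (calc_newtonInv hM hpos hG.union D hDdeg Set.subset_union_right a) le_rfl
  have hmul := (hnum.union hI).trans (Calc.coeffFns_mul (hM.within (2 ^ a)) hG.union
    (fun ω => (hrefl ω).trans hda.le) (fun ω => (natDegree_newtonInv_le _ _ _).trans (by omega))
    (Set.subset_union_left.trans Set.subset_union_right)
    (Set.subset_union_right.trans Set.subset_union_right)) le_rfl
  set H : Ω → R[X] := fun ω =>
    (Polynomial.X ^ (2 ^ a - 1 - d) * ((p ω).reflect d * I ω)).slice 0 (2 ^ a) with hH
  have hdown := calc_coeff_revProd_erase_mul hM a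
    (hG.union (O := coeffFns fun ω => (p ω).reflect d * I ω)) (fun l _ => y l)
    (fun l hl => .inl (hy l hl)) H (fun ω => Polynomial.natDegree_slice_le _ _ _)
    (coeffFns_slice_subset (.inl hG.zero_mem) (coeffFns_X_pow_mul_subset (.inl hG.zero_mem)
      Set.subset_union_right _) _ _)
  have hval : (fun j ω => (revProd ((Finset.range (2 ^ a)).erase j) y * H ω).coeff (2 ^ a - 1)) ''
      Finset.range (2 ^ a) = (fun j ω => (p ω).eval (y j)) '' Finset.range (2 ^ a) := by
    refine Set.image_congr fun j hj => funext fun ω => ?_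
    refine coeff_revProd_erase_mul_eq_eval (p ω) d (2 ^ a) (hp ω) hda y (I ω) ?_ j
      (by simpa using hj)
    refine X_pow_dvd_one_sub_mul_newtonInv _ _ ?_ _ le_rfl
    simp [revProd, Polynomial.coeff_zero_prod]
  rw [hval] at hdown
  refine hmul.trans hdown ?_
  have h1 := hM.le_self hpos
  have h2 := hM.nonneg (2 ^ a)
  have h3 : (d : ℝ) + 1 ≤ ((2 ^ a : ℕ) : ℝ) := by exact_mod_cast hda
  nlinarith [(Nat.cast_nonneg a : (0 : ℝ) ≤ a), mul_nonneg h2 (sq_nonneg (a : ℝ)),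
      mul_nonneg h2 (Nat.cast_nonneg a : (0 : ℝ) ≤ a)]

end Multipoint

/-! ### Programs for block lower triangular matrices -/

section Matrices

variable {Ω R : Type*} [CommRing R] {S : Set R} {G : Set (Ω → R)} {m n : ℕ}

/-- Multiplying an `n × m` by an `m × m` matrix costs at least one operation for each entry of the
product. -/
theorem MatMulWithin.card_le [Nontrivial R] {t : ℝ} (hm : 1 ≤ m) (h : MatMulWithin R S m n t) :
    (m : ℝ) * n ≤ t := by
  let z : Fin m := ⟨0, hm⟩
  have hval : ∀ (i i' : Fin n) (j j' : Fin m),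
      ((Matrix.single i z (1 : R)) * (Matrix.single z j (1 : R))) i' j' =
        Matrix.single i j 1 i' j' := fun i i' j j' => by
    rw [Matrix.single_mul_single_same, one_mul]
  have := Calc.card_le (ι := Fin n × Fin m) h (fun q P => (P.1 * P.2) q.1 q.2) ?_
    (fun q => ⟨q.1, q.2, rfl⟩) ?_
  · simpa [mul_comm] using this
  · rintro ⟨i, j⟩ ⟨i', j'⟩ he
    have h1 := congrFun he (Matrix.single i z (1 : R), Matrix.single z j (1 : R))
    simp only [hval, Matrix.single_apply_same] at h1
    by_contra hne
    rw [Matrix.single_apply_of_ne] at h1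
    · exact one_ne_zero h1
    · rintro ⟨rfl, rfl⟩
      exact hne rfl
  · rintro ⟨i, j⟩ (⟨c, -, hc⟩ | ⟨k, l, hc⟩ | ⟨k, l, hc⟩)
    · have h0 := congrFun hc (0, 0)
      have h1 := congrFun hc (Matrix.single i z (1 : R), Matrix.single z j (1 : R))
      simp only [hval, Matrix.single_apply_same] at h1
      rw [Matrix.zero_mul, Matrix.zero_apply] at h0
      exact zero_ne_one (h0.trans h1.symm)
    · have h1 := congrFun hc (Matrix.single k l (1 : R), 0)
      simp at h1
    · have h1 := congrFun hc (0, Matrix.single k l (1 : R))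
      simp at h1

/-- Zero top right block and diagonal bottom right block. -/
def IsBlockLower (X : Matrix (Fin m ⊕ Fin n) (Fin m ⊕ Fin n) R) : Prop :=
  (∀ i j, X (.inl i) (.inr j) = 0) ∧ ∀ i j, i ≠ j → X (.inr i) (.inr j) = 0

theorem IsBlockLower.one : IsBlockLower (1 : Matrix (Fin m ⊕ Fin n) (Fin m ⊕ Fin n) R) :=
  ⟨fun _ _ => Matrix.one_apply_ne (by simp), fun _ _ h => Matrix.one_apply_ne (by simpa using h)⟩

section Mul

variable {X Y : Matrix (Fin m ⊕ Fin n) (Fin m ⊕ Fin n) R}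

theorem IsBlockLower.mul_inl_inl (hX : IsBlockLower X) (i j : Fin m) :
    (X * Y) (.inl i) (.inl j) = (X.toBlocks₁₁ * Y.toBlocks₁₁) i j := by
  simp [Matrix.mul_apply, Fintype.sum_sum_type, hX.1, Matrix.toBlocks₁₁]

theorem IsBlockLower.mul_inr_inl (hX : IsBlockLower X) (i : Fin n) (j : Fin m) :
    (X * Y) (.inr i) (.inl j) = (X.toBlocks₂₁ * Y.toBlocks₁₁) i j +
      X (.inr i) (.inr i) * Y (.inr i) (.inl j) := by
  rw [Matrix.mul_apply, Fintype.sum_sum_type, Finset.sum_eq_single (s := Finset.univ) (a := i)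
    (f := fun k => X (.inr i) (.inr k) * _)]
  · rfl
  · intro k _ hk
    rw [hX.2 _ _ hk.symm, zero_mul]
  · simp

theorem IsBlockLower.mul_inr_inr (hX : IsBlockLower X) (hY : IsBlockLower Y) (i j : Fin n) :
    (X * Y) (.inr i) (.inr j) = X (.inr i) (.inr i) * Y (.inr i) (.inr j) := by
  rw [Matrix.mul_apply, Fintype.sum_sum_type, Finset.sum_eq_single (s := Finset.univ) (a := i)
    (f := fun k => X (.inr i) (.inr k) * _), Finset.sum_eq_zero, zero_add]
  · intro k _
    rw [hY.1, mul_zero]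
  · intro k _ hk
    rw [hX.2 _ _ hk.symm, zero_mul]
  · simp

theorem IsBlockLower.mul (hX : IsBlockLower X) (hY : IsBlockLower Y) : IsBlockLower (X * Y) := by
  refine ⟨fun i j => ?_, fun i j hij => ?_⟩
  · simp [Matrix.mul_apply, Fintype.sum_sum_type, hX.1, hY.1]
  · rw [hX.mul_inr_inr hY, hY.2 _ _ hij, mul_zero]

end Mul

/-- The entries of a matrix depending on the instance, as quantities. -/
def entryFns {ι : Type*} (X : Ω → Matrix ι ι R) : Set (Ω → R) :=
  {f | ∃ i j, f = fun ω => X ω i j}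

/-- The positions of the entries of a block lower triangular matrix that may differ from zero. -/
def blockPositions (m n : ℕ) : Finset ((Fin m ⊕ Fin n) × (Fin m ⊕ Fin n)) :=
  (Finset.univ.image fun q : Fin m × Fin m => (.inl q.1, .inl q.2)) ∪
    (Finset.univ.image fun q : Fin n × Fin m => (.inr q.1, .inl q.2)) ∪
    Finset.univ.image fun i : Fin n => (.inr i, .inr i)

theorem card_blockPositions_le (hm : 1 ≤ m) :
    ((blockPositions m n).card : ℝ) ≤ 2 * ((m : ℝ) ^ 2 + m * n) := by
  have h1 : (blockPositions m n).card ≤ m * m + n * m + n := by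
    refine (Finset.card_union_le _ _).trans (Nat.add_le_add ((Finset.card_union_le _ _).trans
      (Nat.add_le_add ?_ ?_)) ?_)
    all_goals exact Finset.card_image_le.trans (by simp)
  have h2 : ((blockPositions m n).card : ℝ) ≤ m * m + n * m + n := by exact_mod_cast h1
  have h3 : (1 : ℝ) ≤ m := by exact_mod_cast hm
  nlinarith [(Nat.cast_nonneg n : (0 : ℝ) ≤ n)]

theorem entryFns_subset {X : Ω → Matrix (Fin m ⊕ Fin n) (Fin m ⊕ Fin n) R}
    (hX : ∀ ω, IsBlockLower (X ω)) {O : Set (Ω → R)} (h0 : 0 ∈ O)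
    (h : ∀ q ∈ blockPositions m n, (fun ω => X ω q.1 q.2) ∈ O) : entryFns X ⊆ O := by
  rintro _ ⟨i | i, j | j, rfl⟩
  · exact h (.inl i, .inl j) (by simp [blockPositions])
  · simp only [(hX _).1]; exact h0
  · exact h (.inr i, .inl j) (by simp [blockPositions])
  · by_cases hij : i = j
    · subst hij
      exact h (.inr i, .inr i) (by simp [blockPositions])
    · simp only [(hX _).2 _ _ hij]; exact h0

/-- Families of block lower triangular matrices can be computed one position at a time. -/
theorem calc_entryFns {κ : Type*} (hm : 1 ≤ m) (K : Finset κ) {t : ℝ} (ht : 0 ≤ t)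
    (X : κ → Ω → Matrix (Fin m ⊕ Fin n) (Fin m ⊕ Fin n) R)
    (hX : ∀ k ω, IsBlockLower (X k ω)) (h0 : 0 ∈ G)
    (h : ∀ q ∈ blockPositions m n, Calc G ((fun k ω => X k ω q.1 q.2) '' K) t) :
    Calc G (⋃ k ∈ K, entryFns (X k)) (2 * ((m : ℝ) ^ 2 + m * n) * t) := by
  refine (Calc.biUnion_const (blockPositions m n) _ h).trans (t₂ := 0) (.of_subset ?_ le_rfl) ?_
  · refine Set.iUnion₂_subset fun k hk => entryFns_subset (hX k) (.inl h0) fun q hq => .inr ?_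
    simp only [Set.mem_iUnion]
    exact ⟨q, hq, k, hk, rfl⟩
  · rw [add_zero]
    exact mul_le_mul_of_nonneg_right (card_blockPositions_le hm) ht

/-- The product of two block lower triangular matrices. -/
theorem calc_entryFns_mul {t₁ t₂ : ℝ} (hm : 1 ≤ m) (hmn : (m : ℝ) * n ≤ t₂)
    (h₁ : MatMulWithin R S m m t₁) (h₂ : MatMulWithin R S m n t₂) (hG : HasConsts S G)
    (X Y : Ω → Matrix (Fin m ⊕ Fin n) (Fin m ⊕ Fin n) R) (hX : ∀ ω, IsBlockLower (X ω))
    (hY : ∀ ω, IsBlockLower (Y ω)) (hXG : entryFns X ⊆ G) (hYG : entryFns Y ⊆ G) :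
    Calc G (entryFns fun ω => X ω * Y ω) (4 * (t₁ + t₂)) := by
  have hAA : Calc G {f | ∃ i j, f = fun ω => ((X ω).toBlocks₁₁ * (Y ω).toBlocks₁₁) i j} t₁ := by
    refine (Calc.comp h₁ (fun ω => ((X ω).toBlocks₁₁, (Y ω).toBlocks₁₁)) (G' := G) ?_).mono
      subset_rfl ?_ le_rfl
    · rintro _ (⟨c, hc, rfl⟩ | ⟨k, l, rfl⟩ | ⟨k, l, rfl⟩)
      · exact hG.const_mem c hc
      · exact hXG ⟨.inl k, .inl l, rfl⟩
      · exact hYG ⟨.inl k, .inl l, rfl⟩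
    · rintro _ ⟨i, j, rfl⟩
      exact ⟨_, ⟨i, j, rfl⟩, rfl⟩
  have hBA : Calc G {f | ∃ i j, f = fun ω => ((X ω).toBlocks₂₁ * (Y ω).toBlocks₁₁) i j} t₂ := by
    refine (Calc.comp h₂ (fun ω => ((X ω).toBlocks₂₁, (Y ω).toBlocks₁₁)) (G' := G) ?_).mono
      subset_rfl ?_ le_rfl
    · rintro _ (⟨c, hc, rfl⟩ | ⟨k, l, rfl⟩ | ⟨k, l, rfl⟩)
      · exact hG.const_mem c hc
      · exact hXG ⟨.inr k, .inl l, rfl⟩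
      · exact hYG ⟨.inl k, .inl l, rfl⟩
    · rintro _ ⟨i, j, rfl⟩
      exact ⟨_, ⟨i, j, rfl⟩, rfl⟩
  have hB : Calc G ((fun (q : Fin n × Fin m) ω => (X ω * Y ω) (.inr q.1) (.inl q.2)) ''
      (Finset.univ : Finset (Fin n × Fin m))) (t₂ + 2 * (m * n)) := by
    refine hBA.trans (Calc.family (t := 2) _ _ fun q _ => ?_) (by simp; linarith)
    refine ((Calc.var (.inr ⟨q.1, q.2, rfl⟩)).add ((Calc.var
      (.inl (hXG ⟨.inr q.1, .inr q.1, rfl⟩))).mul (Calc.var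
      (.inl (hYG ⟨.inr q.1, .inl q.2, rfl⟩))))).mono subset_rfl ?_ (by norm_num)
    rintro _ rfl
    exact funext fun ω => (hX ω).mul_inr_inl q.1 q.2
  have hD : Calc G ((fun (i : Fin n) ω => (X ω * Y ω) (.inr i) (.inr i)) ''
      (Finset.univ : Finset (Fin n))) n := by
    refine (Calc.family (t := 1) _ _ fun i _ => ?_).mono subset_rfl subset_rfl (by simp)
    refine ((Calc.var (hXG ⟨.inr i, .inr i, rfl⟩)).mul (Calc.var
      (hYG ⟨.inr i, .inr i, rfl⟩))).mono subset_rfl ?_ (by norm_num)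
    rintro _ rfl
    exact funext fun ω => (hX ω).mul_inr_inr (hY ω) i i
  refine ((hAA.union hB).union hD).trans (t₂ := 0) (.of_subset ?_ le_rfl) ?_
  · refine entryFns_subset (fun ω => (hX ω).mul (hY ω)) (.inl hG.zero_mem) fun q hq => .inr ?_
    simp only [blockPositions, Finset.mem_union, Finset.mem_image, Finset.mem_univ, true_and] at hq
    rcases hq with (⟨q, rfl⟩ | ⟨q, rfl⟩) | ⟨i, rfl⟩
    · refine .inl (.inl ⟨q.1, q.2, ?_⟩)
      exact funext fun ω => (hX ω).mul_inl_inl q.1 q.2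
    · exact .inl (.inr ⟨q, by simp, rfl⟩)
    · exact .inr ⟨i, by simp, rfl⟩
  · have h3 : (1 : ℝ) ≤ m := by exact_mod_cast hm
    have h4 := Calc.nonneg h₁
    nlinarith [(Nat.cast_nonneg n : (0 : ℝ) ≤ n)]

end Matrices

/-! ### Windows of the product -/

section IntervalProducts

variable {R : Type*} [CommRing R] {S : Set R} {m n : ℕ} {G : Set (BlockLinearMatrix R m n → R)}

/-- The product `M(x, x + h)` of the `h` matrices following the integer `x`. -/
noncomputable def windowProduct (h x : ℕ) (M : BlockLinearMatrix R m n) :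
    Matrix (Fin m ⊕ Fin n) (Fin m ⊕ Fin n) R :=
  intervalProduct M.1 x (x + h)

theorem windowProduct_zero (x : ℕ) (M : BlockLinearMatrix R m n) : windowProduct 0 x M = 1 := by
  cases x with
  | zero => rfl
  | succ x => exact if_neg (by omega)

theorem windowProduct_succ (h x : ℕ) (M : BlockLinearMatrix R m n) :
    windowProduct (h + 1) x M =
      M.1.map (Polynomial.eval ((x + h + 1 : ℕ) : R)) * windowProduct h x M :=
  if_pos (Nat.le_add_right x h)

theorem windowProduct_add (h k x : ℕ) (M : BlockLinearMatrix R m n) :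
    windowProduct (h + k) x M = windowProduct k (x + h) M * windowProduct h x M := by
  induction k with
  | zero => rw [windowProduct_zero, one_mul, add_zero]
  | succ k ih =>
    rw [← add_assoc, windowProduct_succ, ih, windowProduct_succ, Matrix.mul_assoc,
      show x + (h + k) + 1 = x + h + k + 1 by ring]

theorem windowProduct_one (x : ℕ) (M : BlockLinearMatrix R m n) :
    windowProduct 1 x M = M.1.map (Polynomial.eval ((x + 1 : ℕ) : R)) := by
  have := windowProduct_succ 0 x M
  rwa [windowProduct_zero, Matrix.mul_one] at this

theorem isBlockLower_windowProduct (h x : ℕ) (M : BlockLinearMatrix R m n) :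
    IsBlockLower (windowProduct h x M) := by
  induction h with
  | zero => rw [windowProduct_zero]; exact .one
  | succ h ih =>
    rw [windowProduct_succ]
    refine IsBlockLower.mul ⟨fun i j => ?_, fun i j hij => ?_⟩ ih
    · have : M.1 (.inl i) (.inr j) = 0 := congrFun (congrFun M.2.2.1 i) j
      simp [this]
    · have : M.1 (.inr i) (.inr j) = 0 := M.2.2.2 hij
      simp [this]

/-- The entries of `windowProduct h x` are polynomials of degree at most `h` in `x`. -/
theorem exists_polynomial_windowProduct (h : ℕ) :
    ∃ p : BlockLinearMatrix R m n → Matrix (Fin m ⊕ Fin n) (Fin m ⊕ Fin n) R[X],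
      (∀ M i j, (p M i j).natDegree ≤ h) ∧
      ∀ M (x : ℕ) i j, (p M i j).eval (x : R) = windowProduct h x M i j := by
  induction h with
  | zero =>
    refine ⟨fun _ => 1, fun M i j => ?_, fun M x i j => ?_⟩
    · beta_reduce
      rw [Matrix.one_apply]; split_ifs <;> simp
    · beta_reduce
      rw [windowProduct_zero, Matrix.one_apply, Matrix.one_apply]; split_ifs <;> simp
  | succ h ih =>
    obtain ⟨p, hp, hpe⟩ := ih
    refine ⟨fun M => M.1.map (fun q => q.comp (Polynomial.X + Polynomial.C ((h + 1 : ℕ) : R))) *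
      p M, fun M i j => ?_, fun M x i j => ?_⟩
    · beta_reduce
      rw [Matrix.mul_apply]
      refine Polynomial.natDegree_sum_le_of_forall_le _ _ fun k _ => ?_
      refine Polynomial.natDegree_mul_le.trans ?_
      have h1 : ((M.1 i k).comp (Polynomial.X + Polynomial.C ((h + 1 : ℕ) : R))).natDegree ≤ 1 :=
        Polynomial.natDegree_comp_le.trans ((Nat.mul_le_mul (M.2.1 i k) (by compute_degree)).trans
          (one_mul 1).le)
      exact (Nat.add_le_add h1 (hp M k j)).trans_eq (add_comm 1 h)
    · beta_reduce
      rw [windowProduct_succ, Matrix.mul_apply, Matrix.mul_apply, Polynomial.eval_finsetSum]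
      refine Finset.sum_congr rfl fun k _ => ?_
      rw [Polynomial.eval_mul, hpe]
      simp only [Matrix.map_apply, Polynomial.eval_comp, Polynomial.eval_add, Polynomial.eval_X,
        Polynomial.eval_C]
      push_cast
      rw [add_assoc]

/-- The entries of `windowProduct h x`, as quantities. -/
def windowFns (R : Type*) [CommRing R] (m n h x : ℕ) : Set (BlockLinearMatrix R m n → R) :=
  entryFns (windowProduct h x)

/-- Multiplying two block lower triangular matrices depending on an instance costs `τ` operations,
and `τ` is at least `m ^ 2 + m n`, the number of nonzero entries up to a factor `2`. -/
structure IsBlockMulCost (R : Type*) [CommRing R] (S : Set R) (m n : ℕ) (τ : ℝ) : Prop where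
  one_mem : (1 : R) ∈ S
  one_le : 1 ≤ m
  size_le : (m : ℝ) ^ 2 + m * n ≤ τ
  calc_mul : ∀ {G : Set (BlockLinearMatrix R m n → R)}
    {X Y : BlockLinearMatrix R m n → Matrix (Fin m ⊕ Fin n) (Fin m ⊕ Fin n) R},
    HasConsts S G → (∀ ω, IsBlockLower (X ω)) → (∀ ω, IsBlockLower (Y ω)) → entryFns X ⊆ G →
    entryFns Y ⊆ G → Calc G (entryFns fun ω => X ω * Y ω) τ

variable {τ : ℝ}

theorem IsBlockMulCost.one_le_cost (hτ : IsBlockMulCost R S m n τ) : 1 ≤ τ := by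
  have h1 : (1 : ℝ) ≤ m := by exact_mod_cast hτ.one_le
  nlinarith [hτ.size_le, mul_nonneg (Nat.cast_nonneg m : (0 : ℝ) ≤ m) (Nat.cast_nonneg n)]

/-- The empty product consists of the constants `0` and `1`. -/
theorem windowFns_zero_subset (hτ : IsBlockMulCost R S m n τ) (hG : HasConsts S G) (x : ℕ) :
    windowFns R m n 0 x ⊆ G := by
  rintro _ ⟨i, j, rfl⟩
  by_cases hij : i = j
  · subst hij
    convert hG.const_mem 1 hτ.one_mem using 2
    rw [windowProduct_zero, Matrix.one_apply_eq]
  · convert hG.zero_mem using 1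
    ext M
    rw [windowProduct_zero, Matrix.one_apply_ne hij]
    rfl

theorem calc_windowFns_add (hτ : IsBlockMulCost R S m n τ) (hG : HasConsts S G) {h k x : ℕ}
    (h₁ : windowFns R m n h x ⊆ G) (h₂ : windowFns R m n k (x + h) ⊆ G) :
    Calc G (windowFns R m n (h + k) x) τ := by
  have := hτ.calc_mul hG (isBlockLower_windowProduct k (x + h)) (isBlockLower_windowProduct h x)
    h₂ h₁
  have he : (fun M : BlockLinearMatrix R m n => windowProduct k (x + h) M * windowProduct h x M) =
      windowProduct (h + k) x := funext fun M => (windowProduct_add h k x M).symm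
  rwa [he] at this

/-- A window of length `q h` is the product of `q` adjacent windows of length `h`. -/
theorem calc_windowFns_chain (hτ : IsBlockMulCost R S m n τ) (hG : HasConsts S G) (h x q : ℕ)
    (hq : ∀ j < q, windowFns R m n h (x + j * h) ⊆ G) :
    Calc G (windowFns R m n (q * h) x) (q * τ) := by
  induction q with
  | zero => simpa using Calc.of_subset (windowFns_zero_subset hτ hG x) le_rfl
  | succ q ih =>
    refine (ih fun j hj => hq j (by omega)).trans (t₂ := τ) ?_ (by push_cast; linarith)
    rw [Nat.succ_mul]
    exact calc_windowFns_add hτ hG.union Set.subset_union_right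
      ((hq q (by omega)).trans Set.subset_union_left)

/-- The coefficients of the entries, as quantities. -/
def blockInputs (R : Type*) [CommRing R] (m n : ℕ) : Set (BlockLinearMatrix R m n → R) :=
  {f | ∃ i j, ∃ k ≤ 1, f = fun M => (M.1 i j).coeff k}

theorem calc_windowFns_one (hm : 1 ≤ m) (hG : HasConsts S G)
    (hin : blockInputs R m n ⊆ G) (x : ℕ) (hx : (fun _ => ((x + 1 : ℕ) : R)) ∈ G) :
    Calc G (windowFns R m n 1 x) (2 * ((m : ℝ) ^ 2 + m * n) * 2) := by
  refine (calc_entryFns (κ := Unit) hm {()} (by norm_num) (fun _ => windowProduct 1 x)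
    (fun _ => isBlockLower_windowProduct 1 x) hG.zero_mem fun q _ => ?_).mono subset_rfl
    (Set.subset_iUnion₂ (s := fun (_ : Unit) _ => windowFns R m n 1 x) () (by simp)) le_rfl
  refine ((Calc.var (hin ⟨q.1, q.2, 0, by norm_num, rfl⟩)).add ((Calc.var
    (hin ⟨q.1, q.2, 1, le_rfl, rfl⟩)).mul (Calc.var hx))).mono subset_rfl ?_ (by norm_num)
  rintro _ ⟨_, _, rfl⟩
  refine funext fun M => ?_
  have h1 := Polynomial.eq_X_add_C_of_natDegree_le_one (M.2.1 q.1 q.2)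
  simp only [windowProduct_one, Matrix.map_apply, Pi.add_apply, Pi.mul_apply]
  conv_lhs => rw [h1]
  simp
  ring

end IntervalProducts

/-! ### Scalars and shifts of windows -/

section BabySteps

variable {R : Type*} [CommRing R] {S : Set R} {m n : ℕ} {G G' : Set (BlockLinearMatrix R m n → R)}
  {M : ℕ → ℝ} {μ : ℝ}

/-- The given quantities include the constants from `S`, the input, the integers of absolute value
at most `B` and the inverses of the nonzero integers of absolute value at most `D`. -/
structure HasScalars (S : Set R) (G : Set (BlockLinearMatrix R m n → R)) (B D : ℕ) : Prop where
  consts : HasConsts S G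
  inputs : blockInputs R m n ⊆ G
  int_mem : ∀ z : ℤ, |z| ≤ B → (fun _ => (z : R)) ∈ G
  inv_mem : ∀ z : ℤ, z ≠ 0 → |z| ≤ D → IsUnit (z : R) ∧ (fun _ => Ring.inverse (z : R)) ∈ G

theorem HasScalars.mono {B D : ℕ} (h : HasScalars S G B D) (hG : G ⊆ G') : HasScalars S G' B D :=
  ⟨h.consts.mono hG, h.inputs.trans hG, fun z hz => hG (h.int_mem z hz),
    fun z hz hzD => ⟨(h.inv_mem z hz hzD).1, hG (h.inv_mem z hz hzD).2⟩⟩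

theorem HasScalars.union {B D : ℕ} {O : Set (BlockLinearMatrix R m n → R)}
    (h : HasScalars S G B D) : HasScalars S (G ∪ O) B D :=
  h.mono Set.subset_union_left

theorem HasScalars.nat_mem {B D : ℕ} (h : HasScalars S G B D) (j : ℕ) (hj : j ≤ B) :
    (fun _ => (j : R)) ∈ G := by
  simpa using h.int_mem j (by simpa using hj)

theorem HasScalars.hasInverses {B D : ℕ} (h : HasScalars S G B D) : HasInverses G D :=
  fun j hj hjD => by simpa using h.inv_mem j (by omega) (by simpa using hjD)

/-- The scalars are computed once, in time linear in `B` and `D`. -/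
theorem calc_hasScalars (h1 : (1 : R) ∈ S) (B D : ℕ)
    (hinv : ∀ j : ℕ, 2 ≤ j → j ≤ D → IsUnit (j : R) ∧ Ring.inverse (j : R) ∈ S) :
    ∃ O : Set (BlockLinearMatrix R m n → R),
      Calc ({f | ∃ c ∈ S, f = fun _ => c} ∪ blockInputs R m n) O (2 * B + D + 2) ∧
      HasScalars S ({f | ∃ c ∈ S, f = fun _ => c} ∪ blockInputs R m n ∪ O) B D := by
  set G : Set (BlockLinearMatrix R m n → R) :=
    {f | ∃ c ∈ S, f = fun _ => c} ∪ blockInputs R m n with hGdef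
  have hS : ∀ c ∈ S, (fun _ => c) ∈ G := fun c hc => .inl ⟨c, hc, rfl⟩
  have hinv' : ∀ j : ℕ, 1 ≤ j → j ≤ D → IsUnit (j : R) ∧ Ring.inverse (j : R) ∈ S := by
    intro j hj hjD
    rcases hj.eq_or_lt with rfl | hj
    · simpa using h1
    · exact hinv j hj hjD
  set nat : ℕ → BlockLinearMatrix R m n → R := fun j _ => (j : R) with hnat
  have hz : Calc G {nat 0} 1 := ((Calc.var (hS 1 h1)).sub (Calc.var (hS 1 h1))).mono subset_rfl
    (by rintro _ rfl; ext; simp [hnat]) (by norm_num)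
  have hpos := Calc.seq (fun j => {nat j}) B (fun _ => 1) hz fun k _ =>
    ((Calc.var (.inr rfl)).add (Calc.var (.inl (hS 1 h1)))).mono subset_rfl
      (by rintro _ rfl; ext; simp [hnat]) (by norm_num)
  set N : Set (BlockLinearMatrix R m n → R) := ⋃ k ∈ Finset.range (B + 1), {nat k}
  have hN : ∀ k ≤ B, nat k ∈ N := fun k hk => by
    simp only [N, Set.mem_iUnion]
    exact ⟨k, by simpa [Nat.lt_succ_iff] using hk, rfl⟩
  have hneg : Calc (G ∪ N) ((fun k => -nat k) '' Finset.Icc 1 B) (B * 1) := by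
    refine (Calc.family (t := 1) (Finset.Icc 1 B) _ fun k hk => ?_).mono subset_rfl subset_rfl
      (by simp)
    refine ((Calc.var (.inr (hN 0 (Nat.zero_le _)))).sub (Calc.var (.inr (hN k
      (Finset.mem_Icc.1 hk).2)))).mono subset_rfl ?_ (by norm_num)
    rintro _ rfl; ext; simp [hnat]
  set I : ℕ → BlockLinearMatrix R m n → R := fun k _ => -Ring.inverse (k : R) with hI
  have hnegI : Calc (G ∪ N) (I '' Finset.Icc 1 D) (D * 1) := by
    refine (Calc.family (t := 1) (Finset.Icc 1 D) _ fun k hk => ?_).mono subset_rfl subset_rfl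
      (by simp)
    refine ((Calc.var (.inr (hN 0 (Nat.zero_le _)))).sub (Calc.var (.inl (hS _ (hinv' k
      (Finset.mem_Icc.1 hk).1 (Finset.mem_Icc.1 hk).2).2)))).mono subset_rfl ?_ (by norm_num)
    rintro _ rfl; ext; simp [hnat, hI]
  refine ⟨_, (hpos.bind (hneg.union hnegI)).mono subset_rfl subset_rfl (by simp; linarith), ?_⟩
  refine ⟨⟨fun c hc => .inl (hS c hc), ?_⟩, Set.subset_union_right.trans Set.subset_union_left,
    fun z hz => ?_, fun z hz hzD => ?_⟩
  · refine .inr (.inl ?_)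
    convert hN 0 (Nat.zero_le _) using 1
    ext; simp [hnat]
  · obtain ⟨k, rfl | rfl⟩ := z.eq_nat_or_neg
    · refine .inr (.inl ?_)
      simpa using hN k (by simpa using hz)
    · rcases Nat.eq_zero_or_pos k with rfl | hk
      · refine .inr (.inl ?_)
        convert hN 0 (Nat.zero_le _) using 1
        ext; simp [hnat]
      · refine .inr (.inr (.inl ⟨k, ?_, ?_⟩))
        · simpa using ⟨hk, by simpa using hz⟩
        · ext; simp [hnat]
  · obtain ⟨k, rfl | rfl⟩ := z.eq_nat_or_neg
    · have := hinv' k (by omega) (by simpa using hzD)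
      simpa using ⟨this.1, Or.inl (hS _ this.2)⟩
    · have := hinv' k (by omega) (by simpa using hzD)
      refine ⟨by simpa using this.1, .inr (.inr (.inr ⟨k, ?_, ?_⟩))⟩
      · simpa using ⟨by omega, by simpa using hzD⟩
      · ext ω
        simp only [hI, Int.cast_neg, Int.cast_natCast]
        obtain ⟨u, hu⟩ := this.1
        rw [← hu, ← Units.val_neg, Ring.inverse_unit, Ring.inverse_unit, inv_neg, Units.val_neg]

/-- Shifting the arithmetic progression `x, x + v, …, x + d v` by `b`, for windows of length `d`;
here `a` is the quotient `b / v` in `R`. -/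
theorem calc_windowFns_shift (hM : IsPolyMulCost R S M) (hm : 1 ≤ m) (hG : HasConsts S G) {d : ℕ}
    (hd : 1 ≤ d) (hinv : HasInverses G d) (x v b : ℕ) (a : R) (hab : (v : R) * a = b) (c : ℕ → R)
    (hc : ∀ j ≤ 2 * d, (a + j - d) * c j = 1)
    (haG : ∀ j ≤ 2 * d, (fun _ => a + j - d) ∈ G) (hcG : ∀ j ≤ 2 * d, (fun _ => c j) ∈ G)
    (h : ∀ i ≤ d, windowFns R m n d (x + v * i) ⊆ G) :
    Calc G (⋃ k ∈ Finset.range (d + 1), windowFns R m n d (x + b + v * k))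
      (16 * ((m : ℝ) ^ 2 + m * n) * M (2 * d)) := by
  obtain ⟨p, hp, hpe⟩ := exists_polynomial_windowProduct (R := R) (m := m) (n := n) d
  refine (calc_entryFns hm (Finset.range (d + 1)) (t := 8 * M (2 * d))
    (mul_nonneg (by norm_num) (hM.nonneg _)) (fun k => windowProduct d (x + b + v * k))
    (fun k => isBlockLower_windowProduct _ _) hG.zero_mem fun q _ => ?_).mono subset_rfl subset_rfl
    (by linarith)
  set P : BlockLinearMatrix R m n → R[X] := fun ω =>
    (p ω q.1 q.2).comp (Polynomial.C (v : R) * Polynomial.X + Polynomial.C (x : R)) with hP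
  have hPdeg : ∀ ω, (P ω).natDegree ≤ d := fun ω =>
    Polynomial.natDegree_comp_le.trans ((Nat.mul_le_mul (hp ω _ _)
      Polynomial.natDegree_linear_le).trans (by simp))
  have hPe : ∀ ω (y : R), (P ω).eval y = (p ω q.1 q.2).eval (v * y + x) := fun ω y => by
    simp [hP]
  refine (calc_eval_shift hM hG hd hinv P hPdeg (fun i hi => ?_) a c hc haG hcG).mono subset_rfl ?_
    le_rfl
  · refine h i hi ⟨q.1, q.2, funext fun ω => ?_⟩
    rw [hPe, ← hpe]
    push_cast
    rw [add_comm]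
  · rintro _ ⟨k, hk, rfl⟩
    refine ⟨k, hk, funext fun ω => ?_⟩
    simp only
    rw [hPe, ← hpe]
    congr 1
    push_cast
    rw [mul_add, hab]
    ring

/-- Shift of the progression by its own length: the quotient `d + 1` is an integer. -/
theorem calc_windowFns_shift_length (hM : IsPolyMulCost R S M) (hm : 1 ≤ m) {B D : ℕ}
    (hG : HasScalars S G B D) {d : ℕ} (hd : 1 ≤ d) (hdB : 2 * d + 1 ≤ B) (hdD : 2 * d + 1 ≤ D)
    (x v : ℕ) (h : ∀ i ≤ d, windowFns R m n d (x + v * i) ⊆ G) :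
    Calc G (⋃ k ∈ Finset.range (d + 1), windowFns R m n d (x + v * (d + 1) + v * k))
      (16 * ((m : ℝ) ^ 2 + m * n) * M (2 * d)) := by
  have he : ∀ j : ℕ, ((d + 1 : ℕ) : R) + j - d = (j + 1 : ℕ) := fun j => by push_cast; ring
  refine calc_windowFns_shift hM hm hG.consts hd (hG.hasInverses.mono subset_rfl (by omega)) x v
    (v * (d + 1)) ((d + 1 : ℕ) : R) (by push_cast; rfl) (fun j => Ring.inverse ((j + 1 : ℕ) : R))
    (fun j hj => ?_) (fun j hj => ?_) (fun j hj => ?_) h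
  · rw [he]
    exact Ring.mul_inverse_cancel _ (hG.hasInverses (j + 1) (by omega) (by omega)).1
  · simp only [he]
    exact hG.nat_mem _ (by omega)
  · exact (hG.hasInverses (j + 1) (by omega) (by omega)).2

/-- The scalars needed for a shift by the fraction `1 / w` of the step. -/
theorem calc_shift_scalars {B D : ℕ} (hG : HasScalars S G B D) {d w : ℕ} (hw : 2 ≤ w) (hd : 1 ≤ d)
    (hB : w * d + 1 ≤ B) (hD : w * d + 1 ≤ D) :
    ∃ (a : R) (c : ℕ → R), (w : R) * a = 1 ∧ (∀ j ≤ 2 * d, (a + j - d) * c j = 1) ∧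
      Calc G (((fun (j : ℕ) _ => a + j - d) '' Finset.range (2 * d + 1)) ∪
        ((fun j _ => c j) '' Finset.range (2 * d + 1))) (2 * (2 * d + 1)) := by
  have hwd : w ≤ w * d := Nat.le_mul_of_pos_right w hd
  have hwu := hG.hasInverses w (by omega) (by omega)
  have hwi := Ring.mul_inverse_cancel _ hwu.1
  -- `z j` is `w` times the difference of a new and an old node; as `w` does not divide `1`, it is
  -- nonzero
  set z : ℕ → ℤ := fun j => 1 + w * ((j : ℤ) - d) with hz
  have hzb : ∀ j ≤ 2 * d, |z j| ≤ (w * d + 1 : ℕ) := fun j hj => by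
    have h1 : |(j : ℤ) - d| ≤ d := abs_le.2 ⟨by omega, by omega⟩
    calc |z j| ≤ |1| + |(w : ℤ) * ((j : ℤ) - d)| := abs_add_le _ _
      _ ≤ 1 + w * d := by
        rw [abs_mul, abs_one, Nat.abs_cast]
        gcongr
      _ = _ := by push_cast; ring
  have hz0 : ∀ j, z j ≠ 0 := fun j h0 => by
    have : (w : ℤ) ∣ 1 := ⟨-((j : ℤ) - d), by simp only [hz] at h0; linarith⟩
    have := Int.le_of_dvd one_pos this
    omega
  have hzu : ∀ j ≤ 2 * d, IsUnit (z j : R) ∧ (fun _ => Ring.inverse (z j : R)) ∈ G := fun j hj =>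
    hG.inv_mem _ (hz0 j) ((hzb j hj).trans (by exact_mod_cast hD))
  have he : ∀ j : ℕ, Ring.inverse (w : R) + j - d = Ring.inverse (w : R) * (z j : R) := fun j => by
    simp only [hz]
    push_cast
    linear_combination (-((j : R) - d)) * hwi
  refine ⟨Ring.inverse (w : R), fun j => w * Ring.inverse (z j : R), hwi, fun j hj => ?_, ?_⟩
  · rw [he]
    have := Ring.mul_inverse_cancel _ (hzu j hj).1
    linear_combination ((z j : R) * Ring.inverse (z j : R)) * hwi + this
  · refine (Calc.union (Calc.family (t := 1) _ _ fun j hj => ?_)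
      (Calc.family (t := 1) _ _ fun j hj => ?_)).mono subset_rfl subset_rfl
      (by push_cast [Finset.card_range]; linarith)
    · have hj : j ≤ 2 * d := by simpa [Nat.lt_succ_iff] using hj
      refine ((Calc.var hwu.2).mul (Calc.var (hG.int_mem (z j) ((hzb j hj).trans
        (by exact_mod_cast hB))))).mono subset_rfl ?_ (by norm_num)
      rintro _ rfl
      exact funext fun _ => he j
    · have hj : j ≤ 2 * d := by simpa [Nat.lt_succ_iff] using hj
      refine ((Calc.var (hG.nat_mem w (by omega))).mul (Calc.var (hzu j hj).2)).mono subset_rfl ?_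
        (by norm_num)
      rintro _ rfl
      rfl

end BabySteps

/-! ### Blocks of length about the square root of `K` -/

section GiantSteps

variable {R : Type*} [CommRing R] {S : Set R} {m n : ℕ} {G : Set (BlockLinearMatrix R m n → R)}
  {M : ℕ → ℝ} {μ : ℝ} {B D : ℕ}

/-- The windows of length `h` that start at `0, v, …, (N - 1) v`. -/
def windowsAt (R : Type*) [CommRing R] (m n h v N : ℕ) : Set (BlockLinearMatrix R m n → R) :=
  ⋃ i ∈ Finset.range N, windowFns R m n h (v * i)

theorem windowFns_subset_windowsAt {h v N i : ℕ} (hi : i < N) :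
    windowFns R m n h (v * i) ⊆ windowsAt R m n h v N :=
  Set.subset_biUnion_of_mem (u := fun i => windowFns R m n h (v * i))
    (Finset.mem_coe.2 (Finset.mem_range.2 hi))

/-- Doubling: windows of length `d` at `0, v, …, d v` yield those of length `2 d` at
`0, v, …, 2 d v`, where `v = w d`. -/
theorem calc_windowsAt_double (hM : IsPolyMulCost R S M) (hμ : IsBlockMulCost R S m n μ)
    (hG : HasScalars S G B D) {d w : ℕ} (hd : 1 ≤ d) (hw : 2 ≤ w) (hB : w * d + 1 ≤ B)
    (hD : w * d + 1 ≤ D) (h : windowsAt R m n d (w * d) (d + 1) ⊆ G) :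
    Calc G (windowsAt R m n (2 * d) (w * d) (2 * d + 1))
      (48 * ((m : ℝ) ^ 2 + m * n) * M (2 * d) + 9 * μ * d) := by
  have hwd : 2 * d ≤ w * d := Nat.mul_le_mul_right d hw
  obtain ⟨a, c, hwa, hac, hsc⟩ := calc_shift_scalars hG hw hd hB hD
  set v := w * d with hv
  have hlow : ∀ i ≤ d, windowFns R m n d (0 + v * i) ⊆ G := fun i hi => by
    rw [zero_add]
    exact (windowFns_subset_windowsAt (Nat.lt_succ_of_le hi)).trans h
  have h1 := calc_windowFns_shift_length hM hμ.one_le hG hd (by omega) (by omega) 0 v hlow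
  set Sc : Set (BlockLinearMatrix R m n → R) :=
    ((fun (j : ℕ) _ => a + j - d) '' Finset.range (2 * d + 1)) ∪
      ((fun j _ => c j) '' Finset.range (2 * d + 1)) with hSc
  set W := ⋃ k ∈ Finset.range (d + 1), windowFns R m n d (0 + v * (d + 1) + v * k) with hW
  have hW' : ∀ k ≤ d, windowFns R m n d (0 + v * (d + 1) + v * k) ⊆ W := fun k hk =>
    Set.subset_biUnion_of_mem (u := fun k => windowFns R m n d (0 + v * (d + 1) + v * k))
      (Finset.mem_coe.2 (Finset.mem_range.2 (Nat.lt_succ_of_le hk)))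
  have hG₁ : HasScalars S (G ∪ (Sc ∪ W)) B D := hG.union
  -- The window of length `2 d` at `v i` is a product of windows at `v i + d` and `v i`: those at
  -- `v i` for `d < i` come from the shift by the length of the progression, and then a shift by `d`
  -- is applied to both halves.
  have hva : (v : R) * a = (d : ℕ) := by
    rw [hv]; push_cast; linear_combination (d : R) * hwa
  have hshift : ∀ x, (∀ i ≤ d, windowFns R m n d (x + v * i) ⊆ G ∪ (Sc ∪ W)) →
      Calc (G ∪ (Sc ∪ W)) (⋃ k ∈ Finset.range (d + 1), windowFns R m n d (x + d + v * k))
        (16 * ((m : ℝ) ^ 2 + m * n) * M (2 * d)) := fun x hx =>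
    calc_windowFns_shift hM hμ.one_le hG₁.consts hd
      (hG₁.hasInverses.mono subset_rfl (by omega)) x v d a hva c hac
      (fun j hj => .inr (.inl (.inl ⟨j, by simpa [Nat.lt_succ_iff] using hj, rfl⟩)))
      (fun j hj => .inr (.inl (.inr ⟨j, by simpa [Nat.lt_succ_iff] using hj, rfl⟩))) hx
  have h2 := hshift 0 fun i hi => (hlow i hi).trans Set.subset_union_left
  have h3 := hshift (0 + v * (d + 1)) fun i hi =>
    (hW' i hi).trans (Set.subset_union_right.trans Set.subset_union_right)
  set W₂ := ⋃ k ∈ Finset.range (d + 1), windowFns R m n d (0 + d + v * k) with hW₂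
  set W₃ := ⋃ k ∈ Finset.range (d + 1), windowFns R m n d (0 + v * (d + 1) + d + v * k) with hW₃
  have h4 := (hsc.union h1).bind (h2.union h3)
  refine h4.trans (Calc.biUnion_const _ _ (t := μ) fun i hi => ?_) ?_
  · rw [two_mul]
    have hi : i < 2 * d + 1 := by simpa using hi
    by_cases hid : i ≤ d
    · refine calc_windowFns_add hμ hG.consts.union ?_ ?_
      · exact (by simpa using hlow i hid : windowFns R m n d (v * i) ⊆ G).trans
          Set.subset_union_left
      · refine Set.Subset.trans ?_ (Set.subset_union_left.trans
          (Set.subset_union_right.trans Set.subset_union_right) : W₂ ⊆ _)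
        rw [show v * i + d = 0 + d + v * i by ring]
        exact Set.subset_biUnion_of_mem (u := fun k => windowFns R m n d (0 + d + v * k))
          (Finset.mem_coe.2 (Finset.mem_range.2 (Nat.lt_succ_of_le hid)))
    · obtain ⟨k, rfl⟩ := Nat.exists_eq_add_of_le (Nat.succ_le_of_lt (not_le.1 hid))
      have hk : k ≤ d := by omega
      refine calc_windowFns_add hμ hG.consts.union ?_ ?_
      · refine Set.Subset.trans ?_ (Set.subset_union_right.trans
          (Set.subset_union_left.trans Set.subset_union_right) : W ⊆ _)
        rw [show v * (d.succ + k) = 0 + v * (d + 1) + v * k by rw [Nat.succ_eq_add_one]; ring]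
        exact hW' k hk
      · refine Set.Subset.trans ?_ (Set.subset_union_right.trans
          (Set.subset_union_right.trans Set.subset_union_right) : W₃ ⊆ _)
        rw [show v * (d.succ + k) + d = 0 + v * (d + 1) + d + v * k by
          rw [Nat.succ_eq_add_one]; ring]
        exact Set.subset_biUnion_of_mem
          (u := fun k => windowFns R m n d (0 + v * (d + 1) + d + v * k))
          (Finset.mem_coe.2 (Finset.mem_range.2 (Nat.lt_succ_of_le hk)))
  · have h5 := hμ.one_le_cost
    have h6 : (1 : ℝ) ≤ d := by exact_mod_cast hd
    push_cast [Finset.card_range]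
    nlinarith

theorem IsPolyMulCost.sum_two_pow_le (hM : IsPolyMulCost R S M) (T : ℕ) :
    ∑ t ∈ Finset.range T, M (2 ^ (t + 1)) ≤ 2 * M (2 ^ T) := by
  induction T with
  | zero => simpa using hM.nonneg 1
  | succ T ih =>
    rw [Finset.sum_range_succ]
    linarith [hM.two_mul_le T]

/-- All the levels of the doubling: windows of length `2 ^ t` for `t ≤ T`, at multiples of
`2 ^ T`. -/
theorem calc_windowsAt_levels (hM : IsPolyMulCost R S M) (hμ : IsBlockMulCost R S m n μ) (T : ℕ)
    (hG : HasScalars S G B D) (hB : 2 ^ T + 1 ≤ B) (hD : 2 ^ T + 1 ≤ D) :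
    Calc G (⋃ t ∈ Finset.range (T + 1), windowsAt R m n (2 ^ t) (2 ^ T) (2 ^ t + 1))
      (96 * ((m : ℝ) ^ 2 + m * n) * M (2 ^ T) + 17 * μ * 2 ^ T) := by
  have h0 : Calc G (windowsAt R m n (2 ^ 0) (2 ^ T) (2 ^ 0 + 1)) (8 * μ) := by
    refine (Calc.biUnion_const (Finset.range (2 ^ 0 + 1)) _ fun i hi => ?_).mono
      (t := _ * (2 * ((m : ℝ) ^ 2 + m * n) * 2)) subset_rfl subset_rfl ?_
    · refine calc_windowFns_one hμ.one_le hG.consts hG.inputs _ (hG.nat_mem _ ?_)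
      have hi : i < 2 := by simpa using hi
      have := Nat.one_le_two_pow (n := T)
      interval_cases i <;> omega
    · have := hμ.size_le
      push_cast [Finset.card_range]
      linarith
  refine (Calc.seq (fun t => windowsAt R m n (2 ^ t) (2 ^ T) (2 ^ t + 1)) T
    (fun t => 48 * ((m : ℝ) ^ 2 + m * n) * M (2 ^ (t + 1)) + 9 * μ * 2 ^ t) h0
    fun t ht => ?_).mono subset_rfl subset_rfl ?_
  · have hv : 2 ^ T = 2 ^ (T - t) * 2 ^ t := by rw [← pow_add, Nat.sub_add_cancel ht.le]
    have hw : 2 ≤ 2 ^ (T - t) := by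
      calc 2 = 2 ^ 1 := rfl
        _ ≤ 2 ^ (T - t) := Nat.pow_le_pow_right (by norm_num) (by omega)
    have := calc_windowsAt_double hM hμ
      (hG.union (O := windowsAt R m n (2 ^ t) (2 ^ T) (2 ^ t + 1))) (d := 2 ^ t) (w := 2 ^ (T - t))
      Nat.one_le_two_pow hw (by omega) (by omega)
      (by rw [← hv]; exact Set.subset_union_right)
    rw [← hv, ← pow_succ'] at this
    exact_mod_cast this
  · have h1 := hM.sum_two_pow_le T
    have h2 : ∑ t ∈ Finset.range T, (2 : ℝ) ^ t = 2 ^ T - 1 := by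
      rw [geom_sum_eq (by norm_num)]; norm_num
    rw [Finset.sum_add_distrib, ← Finset.mul_sum, ← Finset.mul_sum, h2]
    have h3 := hμ.one_le_cost
    have h4 : (1 : ℝ) ≤ 2 ^ T := one_le_pow₀ (by norm_num)
    have h5 : (0 : ℝ) ≤ (m : ℝ) ^ 2 + m * n := by positivity
    nlinarith [mul_le_mul_of_nonneg_left h1 h5]

/-- The windows of length `H` at the multiples of `H` up to a constant times `H ^ 2`. -/
theorem calc_windowsAt_extend (hM : IsPolyMulCost R S M) (hm : 1 ≤ m) (hG : HasScalars S G B D)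
    {H : ℕ} (hH : 1 ≤ H) (hB : 2 * H + 1 ≤ B) (hD : 2 * H + 1 ≤ D)
    (h : windowsAt R m n H H (H + 1) ⊆ G) :
    Calc G (windowsAt R m n H H (17 * (H + 1)))
      (256 * ((m : ℝ) ^ 2 + m * n) * M (2 * H)) := by
  -- sixteen shifts of `H + 1` positions by `H + 1` blocks; longer ones would need larger inverses
  set F : ℕ → Set (BlockLinearMatrix R m n → R) := fun k =>
    ⋃ i ∈ Finset.range (H + 1), windowFns R m n H (H * (H + 1) * k + H * i) with hF
  have hmem : ∀ k i, i ≤ H → windowFns R m n H (H * (H + 1) * k + H * i) ⊆ F k := fun k i hi =>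
    Set.subset_biUnion_of_mem (u := fun i => windowFns R m n H (H * (H + 1) * k + H * i))
      (Finset.mem_coe.2 (Finset.mem_range.2 (Nat.lt_succ_of_le hi)))
  refine ((Calc.seq F 16 (fun _ => 16 * ((m : ℝ) ^ 2 + m * n) * M (2 * H)) (t := 0) ?_
    fun k _ => ?_).mono subset_rfl ?_ (by simp; linarith))
  · refine .of_subset ?_ le_rfl
    simp only [hF, mul_zero, zero_add]
    exact h
  · refine (calc_windowFns_shift_length hM hm (hG.union (O := F k)) hH hB hD (H * (H + 1) * k) H
      fun i hi => (hmem k i hi).trans Set.subset_union_right).mono subset_rfl ?_ le_rfl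
    simp only [hF, mul_add, mul_one, add_assoc]
    exact subset_rfl
  · refine Set.iUnion₂_subset fun i hi => ?_
    have hi : i < 17 * (H + 1) := by simpa using hi
    have hk : i / (H + 1) < 17 := Nat.div_lt_of_lt_mul (by linarith)
    refine Set.Subset.trans ?_ (Set.subset_biUnion_of_mem (u := F) (x := i / (H + 1))
      (Finset.mem_coe.2 (Finset.mem_range.2 hk)))
    have := hmem (i / (H + 1)) (i % (H + 1)) (Nat.lt_succ_iff.1 (Nat.mod_lt _ (by omega)))
    convert this using 2
    conv_lhs => rw [← Nat.div_add_mod i (H + 1)]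
    ring

/-- The windows of length `d` at `2 ^ a` arbitrary positions. -/
theorem calc_windowFns_multipoint (hM : IsPolyMulCost R S M) (hμ : IsBlockMulCost R S m n μ)
    (hG : HasScalars S G B D) {d v a : ℕ} (hda : d < 2 ^ a) (hdB : d ≤ B) (hdD : d ≤ D)
    (hv : 1 ≤ v) (hvD : v ≤ D) (h : windowsAt R m n d v (d + 1) ⊆ G) (x : ℕ → ℕ)
    (hx : ∀ j < 2 ^ a, x j < B * B) :
    Calc G (⋃ j ∈ Finset.range (2 ^ a), windowFns R m n d (x j))
      (9 * ((m : ℝ) ^ 2 + m * n) * (a + 2) ^ 2 * M (2 ^ a)) := by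
  have hvu := hG.hasInverses v hv hvD
  have hvi := Ring.mul_inverse_cancel _ hvu.1
  set y : ℕ → R := fun j => (x j : R) * Ring.inverse (v : R) with hy
  -- positions are below `B ^ 2`, so division with remainder by `B` yields them from given integers
  have hsc : Calc G ((fun j (_ : BlockLinearMatrix R m n) => y j) '' Finset.range (2 ^ a))
      (3 * 2 ^ a) := by
    refine (Calc.family (t := 3) _ _ fun j hj => ?_).mono subset_rfl subset_rfl
      (by push_cast [Finset.card_range]; linarith)
    have hxj := hx j (by simpa using hj)
    have hB : 0 < B := Nat.pos_of_ne_zero (by rintro rfl; simp at hxj)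
    refine ((((Calc.var (hG.nat_mem B le_rfl)).mul (Calc.var (hG.nat_mem (x j / B)
      (Nat.div_lt_of_lt_mul hxj).le))).add (Calc.var (hG.nat_mem (x j % B)
      (Nat.mod_lt _ hB).le))).mul (Calc.var hvu.2)).mono subset_rfl ?_ (by norm_num)
    rintro _ rfl
    refine funext fun _ => ?_
    simp only [hy, Pi.mul_apply, Pi.add_apply]
    conv_lhs => rw [← Nat.div_add_mod (x j) B]
    push_cast
    rfl
  obtain ⟨p, hp, hpe⟩ := exists_polynomial_windowProduct (R := R) (m := m) (n := n) d
  refine hsc.trans (calc_entryFns hμ.one_le (Finset.range (2 ^ a))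
    (t := 4 * (a + 2) ^ 2 * M (2 ^ a)) (mul_nonneg (by positivity) (hM.nonneg _))
    (fun j => windowProduct d (x j)) (fun j => isBlockLower_windowProduct _ _)
    hG.consts.union.zero_mem fun q _ => ?_) ?_
  · set P : BlockLinearMatrix R m n → R[X] := fun ω =>
      (p ω q.1 q.2).comp (Polynomial.C (v : R) * Polynomial.X) with hP
    have hPdeg : ∀ ω, (P ω).natDegree ≤ d := fun ω =>
      Polynomial.natDegree_comp_le.trans ((Nat.mul_le_mul (hp ω _ _)
        (by compute_degree)).trans (mul_one d).le)
    have hPe : ∀ ω (y : R), (P ω).eval y = (p ω q.1 q.2).eval (v * y) := fun ω y => by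
      simp [hP]
    refine (calc_eval_multipoint hM hG.consts.union hda
      (hG.hasInverses.mono Set.subset_union_left hdD)
      (fun i hi => .inl (hG.nat_mem i (hi.trans hdB))) P hPdeg (fun i hi => .inl ?_) y
      fun j hj => .inr ?_).mono subset_rfl ?_ le_rfl
    · refine h (windowFns_subset_windowsAt (Nat.lt_succ_of_le hi) ⟨q.1, q.2, funext fun ω => ?_⟩)
      rw [hPe, ← hpe]
      push_cast
      rfl
    · exact ⟨j, by simpa using hj, rfl⟩
    · rintro _ ⟨j, hj, rfl⟩
      refine ⟨j, hj, funext fun ω => ?_⟩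
      simp only
      rw [hPe, ← hpe]
      congr 1
      simp only [hy]
      linear_combination (x j : R) * hvi
  · have h1 := hM.le_self (d := 2 ^ a) Nat.one_le_two_pow
    have h2 : (1 : ℝ) ≤ (m : ℝ) ^ 2 + m * n := by
      have : (1 : ℝ) ≤ m := by exact_mod_cast hμ.one_le
      nlinarith [mul_nonneg (Nat.cast_nonneg m : (0 : ℝ) ≤ m) (Nat.cast_nonneg n)]
    push_cast at h1
    have h3 : (4 : ℝ) ≤ (a + 2) ^ 2 := by nlinarith [(Nat.cast_nonneg a : (0 : ℝ) ≤ a)]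
    have h4 := hM.nonneg (2 ^ a)
    have h5 : (3 : ℝ) * 2 ^ a ≤ (a + 2) ^ 2 * M (2 ^ a) := by nlinarith
    have h6 : (a + 2) ^ 2 * M (2 ^ a) ≤
        ((m : ℝ) ^ 2 + m * n) * ((a + 2) ^ 2 * M (2 ^ a)) :=
      le_mul_of_one_le_left (by positivity) h2
    linarith

end GiantSteps

/-! ### Initial and final pieces of the intervals -/

section Pieces

variable {R : Type*} [CommRing R] {S : Set R} {m n : ℕ} {G : Set (BlockLinearMatrix R m n → R)}
  {M : ℕ → ℝ} {μ : ℝ} {B D : ℕ}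

theorem windowFns_subset_biUnion {s : Finset ℕ} {h x : ℕ → ℕ} {j : ℕ} (hj : j ∈ s) :
    windowFns R m n (h j) (x j) ⊆ ⋃ j ∈ s, windowFns R m n (h j) (x j) :=
  Set.subset_biUnion_of_mem (u := fun j => windowFns R m n (h j) (x j)) (Finset.mem_coe.2 hj)

/-- Products over `N` intervals of length less than `2 ^ t`, by binary expansion of the length and
one multipoint evaluation for each binary digit. -/
theorem calc_windowFns_binary (hM : IsPolyMulCost R S M) (hμ : IsBlockMulCost R S m n μ)
    (hG : HasScalars S G B D) {T₁ v a N t : ℕ} (hT : 2 ^ T₁ < 2 ^ a) (hTB : 2 ^ T₁ ≤ B)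
    (hTD : 2 ^ T₁ ≤ D) (hv : 1 ≤ v) (hvD : v ≤ D)
    (h : ∀ t ≤ T₁, windowsAt R m n (2 ^ t) v (2 ^ t + 1) ⊆ G) (hN : N ≤ 2 ^ a) (ht : t ≤ T₁ + 1)
    (x l : ℕ → ℕ) (hx : ∀ j, x j + l j < B * B) (hl : ∀ j, l j < 2 ^ t) :
    Calc G (⋃ j ∈ Finset.range N, windowFns R m n (l j) (x j))
      (t * (9 * ((m : ℝ) ^ 2 + m * n) * (a + 2) ^ 2 * M (2 ^ a) + N * μ)) := by
  induction t generalizing x l with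
  | zero =>
    refine .of_subset (Set.iUnion₂_subset fun j _ => ?_) (by simp)
    rw [show l j = 0 by simpa using hl j]
    exact windowFns_zero_subset hμ hG.consts _
  | succ t ih =>
    have htT : 2 ^ t ≤ 2 ^ T₁ := Nat.pow_le_pow_right (by norm_num) (by omega)
    have hm := calc_windowFns_multipoint hM hμ hG (htT.trans_lt hT) (htT.trans hTB)
      (htT.trans hTD) hv hvD (h t (by omega)) x fun j _ => (Nat.le_add_right _ _).trans_lt (hx j)
    have hr := ih (by omega) (fun j => if 2 ^ t ≤ l j then x j + 2 ^ t else x j)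
      (fun j => if 2 ^ t ≤ l j then l j - 2 ^ t else l j)
      (fun j => by have := hx j; split_ifs <;> omega)
      (fun j => by have := hl j; rw [pow_succ] at this; split_ifs <;> omega)
    set W := ⋃ j ∈ Finset.range (2 ^ a), windowFns R m n (2 ^ t) (x j)
    set V := ⋃ j ∈ Finset.range N, windowFns R m n (if 2 ^ t ≤ l j then l j - 2 ^ t else l j)
      (if 2 ^ t ≤ l j then x j + 2 ^ t else x j)
    refine (hm.union hr).trans ((Calc.biUnion_const (Finset.range N) _ (t := μ) fun j hj => ?_))
      (by push_cast [Finset.card_range]; linarith)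
    have h1 : windowFns R m n (2 ^ t) (x j) ⊆ W :=
      windowFns_subset_biUnion (h := fun _ => 2 ^ t) (Finset.mem_range.2
        ((Finset.mem_range.1 hj).trans_le hN))
    have h2 : windowFns R m n (if 2 ^ t ≤ l j then l j - 2 ^ t else l j)
        (if 2 ^ t ≤ l j then x j + 2 ^ t else x j) ⊆ V :=
      windowFns_subset_biUnion (h := fun j => if 2 ^ t ≤ l j then l j - 2 ^ t else l j)
        (x := fun j => if 2 ^ t ≤ l j then x j + 2 ^ t else x j) hj
    have h1' := h1.trans (Set.subset_union_left.trans Set.subset_union_right : W ⊆ G ∪ (W ∪ V))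
    have h2' := h2.trans (Set.subset_union_right.trans Set.subset_union_right : V ⊆ G ∪ (W ∪ V))
    by_cases hb : 2 ^ t ≤ l j
    · simp only [hb, if_true] at h2'
      have := calc_windowFns_add hμ hG.consts.union h1' h2'
      rwa [Nat.add_sub_cancel' hb] at this
    · simp only [hb, if_false] at h2'
      exact .of_subset h2' (zero_le_one.trans hμ.one_le_cost)

/-- Products over `N` intervals of length less than `2 ^ (T₁ + g)`: each is cut into at most `2 ^ g`
windows of length `2 ^ T₁` and a remainder. -/
theorem calc_windowFns_pieces (hM : IsPolyMulCost R S M) (hμ : IsBlockMulCost R S m n μ)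
    (hG : HasScalars S G B D) {T₁ v a N g : ℕ} (hT : 2 ^ T₁ < 2 ^ a) (hTB : 2 ^ T₁ ≤ B)
    (hTD : 2 ^ T₁ ≤ D) (hv : 1 ≤ v) (hvD : v ≤ D)
    (h : ∀ t ≤ T₁, windowsAt R m n (2 ^ t) v (2 ^ t + 1) ⊆ G) (hN : N * 2 ^ g ≤ 2 ^ a)
    (x l : ℕ → ℕ) (hx : ∀ j, x j + l j < B * B) (hl : ∀ j, l j < 2 ^ (T₁ + g)) :
    Calc G (⋃ j ∈ Finset.range N, windowFns R m n (l j) (x j))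
      ((T₁ + 1) * (9 * ((m : ℝ) ^ 2 + m * n) * (a + 2) ^ 2 * M (2 ^ a) + N * μ) +
        N * 2 ^ g * μ) := by
  set h₁ := 2 ^ T₁ with hh₁
  have hpos : 0 < h₁ := by positivity
  have hg : 0 < 2 ^ g := by positivity
  set q : ℕ → ℕ := fun j => l j / h₁ with hq
  have hqg : ∀ j, q j < 2 ^ g := fun j => Nat.div_lt_of_lt_mul (by
    rw [hh₁, ← pow_add]; exact hl j)
  have hdiv : ∀ j, q j * h₁ + l j % h₁ = l j := fun j => Nat.div_add_mod' (l j) h₁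
  -- the position with number `2 ^ g * j + i` is that of the window `i` in the interval `j`
  set y : ℕ → ℕ := fun k =>
    if k % 2 ^ g < q (k / 2 ^ g) then x (k / 2 ^ g) + (k % 2 ^ g) * h₁ else 0 with hy
  have hBB : 0 < B * B := (Nat.zero_le _).trans_lt (hx 0)
  have hyB : ∀ k, y k < B * B := fun k => by
    simp only [hy]
    split_ifs with hk
    · have h1 := hx (k / 2 ^ g)
      have h2 := hdiv (k / 2 ^ g)
      have h3 := Nat.mul_le_mul_right h₁ hk.le
      omega
    · exact hBB
  have hm := calc_windowFns_multipoint hM hμ hG hT hTB hTD hv hvD (h T₁ le_rfl) y fun k _ => hyB k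
  have hyW : ∀ j < N, ∀ i < q j, windowFns R m n h₁ (x j + i * h₁) ⊆
      ⋃ k ∈ Finset.range (2 ^ a), windowFns R m n h₁ (y k) := by
    intro j hj i hi
    have hig : i < 2 ^ g := hi.trans (hqg j)
    have hk1 : (2 ^ g * j + i) / 2 ^ g = j := by
      rw [Nat.mul_add_div hg, Nat.div_eq_of_lt hig, add_zero]
    have hk2 : (2 ^ g * j + i) % 2 ^ g = i := by
      rw [Nat.mul_add_mod, Nat.mod_eq_of_lt hig]
    have hk3 : 2 ^ g * j + i < 2 ^ a := by nlinarith
    have hyk : y (2 ^ g * j + i) = x j + i * h₁ := by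
      simp only [hy, hk1, hk2, hi, if_true]
    rw [← hyk]
    exact windowFns_subset_biUnion (h := fun _ => h₁) (Finset.mem_range.2 hk3)
  have hb := calc_windowFns_binary hM hμ hG hT hTB hTD hv hvD h
    ((Nat.le_mul_of_pos_right N hg).trans hN) (Nat.le_succ T₁) (fun j => x j + q j * h₁)
    (fun j => l j % h₁) (fun j => by have := hx j; have := hdiv j; omega)
    (fun j => Nat.mod_lt _ hpos)
  refine (hm.union hb).trans (t₂ := N * ((2 ^ g - 1 : ℝ) * μ + μ))
    ((Calc.biUnion_const (Finset.range N) _ fun j hj => ?_).mono subset_rfl subset_rfl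
    (by rw [Finset.card_range])) ?_
  · have hj' := Finset.mem_range.1 hj
    have hc := calc_windowFns_chain hμ (hG.union (O := _)).consts h₁ (x j) (q j) fun i hi =>
      (hyW j hj' i hi).trans ((Set.subset_union_left (t := ⋃ j ∈ Finset.range N,
        windowFns R m n (l j % h₁) (x j + q j * h₁))).trans (Set.subset_union_right (s := G)))
    have hd := calc_windowFns_add hμ (hG.consts.union.union) (h := q j * h₁) (k := l j % h₁)
      (x := x j) (G := G ∪ ((⋃ k ∈ Finset.range (2 ^ a), windowFns R m n h₁ (y k)) ∪
        ⋃ j ∈ Finset.range N, windowFns R m n (l j % h₁) (x j + q j * h₁)) ∪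
        windowFns R m n (q j * h₁) (x j)) Set.subset_union_right
      ((windowFns_subset_biUnion (h := fun j => l j % h₁) (x := fun j => x j + q j * h₁) hj).trans
        (Set.subset_union_right.trans (Set.subset_union_right.trans Set.subset_union_left)))
    rw [hdiv] at hd
    refine hc.trans hd ?_
    have : (q j : ℝ) + 1 ≤ 2 ^ g := by exact_mod_cast hqg j
    have h1 := hμ.one_le_cost
    nlinarith
  · have h1 := hμ.one_le_cost
    have h2 : (0 : ℝ) ≤ N * μ := by positivity
    nlinarith

/-- An interval is cut into an initial piece, full blocks of length `H` at multiples of `H`, and a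
final piece. -/
theorem exists_block_decomposition {H : ℕ} (hH : 1 ≤ H) (a b : ℕ) (hab : a ≤ b) :
    ∃ l₁ k l₂ : ℕ, a + l₁ + k * H + l₂ = b ∧ l₁ < H ∧ l₂ < H ∧
      ∀ j < k, ∃ i, a + l₁ + j * H = H * i ∧ H * i ≤ b := by
  by_cases hc : H * ((a + (H - 1)) / H) ≤ b
  · set c := (a + (H - 1)) / H with hcdef
    have h1 := Nat.div_add_mod (a + (H - 1)) H
    have h2 := Nat.mod_lt (a + (H - 1)) (show H > 0 by omega)
    rw [← hcdef] at h1
    have h3 := Nat.div_add_mod (b - H * c) H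
    have h4 := Nat.mod_lt (b - H * c) (show H > 0 by omega)
    refine ⟨H * c - a, (b - H * c) / H, (b - H * c) % H, ?_, ?_, h4, fun j hj => ⟨c + j, ?_, ?_⟩⟩
    · rw [mul_comm _ H]
      omega
    · omega
    · rw [mul_add, mul_comm j]
      omega
    · have := Nat.mul_le_mul_left H hj.le
      rw [mul_add]
      omega
  · have h1 := Nat.div_mul_le_self (a + (H - 1)) H
    rw [mul_comm] at h1
    exact ⟨b - a, 0, 0, by omega, by omega, by omega, fun j hj => by omega⟩

theorem sum_sub_le_of_disjoint {r K : ℕ} (Ks Ls : Fin r → ℕ)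
    (hd : ∀ i j, i < j → Ls i ≤ Ks j) (hK : ∀ i, Ls i ≤ K) :
    ∑ i, (Ls i - Ks i) ≤ K := by
  have h1 : ∑ i, (Ls i - Ks i) = (Finset.univ.biUnion fun i => Finset.Ico (Ks i) (Ls i)).card := by
    rw [Finset.card_biUnion]
    · simp
    · intro i _ j _ hij
      rcases lt_or_gt_of_ne hij with h | h
      · have := hd i j h
        exact Finset.disjoint_left.2 fun x hx hx' => by
          simp only [Finset.mem_Ico] at hx hx'; omega
      · have := hd j i h
        exact Finset.disjoint_left.2 fun x hx hx' => by
          simp only [Finset.mem_Ico] at hx hx'; omega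
  rw [h1]
  refine (Finset.card_le_card (t := Finset.range K) ?_).trans (by simp)
  intro x hx
  obtain ⟨i, -, hi⟩ := Finset.mem_biUnion.1 hx
  have := hK i
  simp only [Finset.mem_Ico] at hi
  simp only [Finset.mem_range]
  omega

end Pieces

/-! ### Assembling the interval products -/

section Intervals

variable {R : Type*} [CommRing R] {S : Set R} {m n : ℕ} {G : Set (BlockLinearMatrix R m n → R)}
  {M : ℕ → ℝ} {μ : ℝ} {B D : ℕ}

/-- The entries of all the interval products, as quantities. -/
def intervalOutputs (R : Type*) [CommRing R] (m n : ℕ) {r : ℕ} (Ks Ls : Fin r → ℕ) :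
    Set (BlockLinearMatrix R m n → R) :=
  {f | ∃ q i j, f = fun M => intervalProduct M.1 (Ks q) (Ls q) i j}

theorem intervalOutputs_subset {r : ℕ} {Ks Ls : Fin r → ℕ} (h : ∀ i, Ks i ≤ Ls i)
    {O : Set (BlockLinearMatrix R m n → R)}
    (hO : ∀ q, windowFns R m n (Ls q - Ks q) (Ks q) ⊆ O) : intervalOutputs R m n Ks Ls ⊆ O := by
  rintro _ ⟨q, i, j, rfl⟩
  refine hO q ⟨i, j, funext fun M => ?_⟩
  rw [windowProduct, Nat.add_sub_cancel' (h q)]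

/-- The direct method: multiply the matrices one by one. -/
theorem calc_intervalOutputs_naive (hμ : IsBlockMulCost R S m n μ) {K r : ℕ}
    (hG : HasScalars S G K 0) (Ks Ls : Fin r → ℕ) (h : ∀ i, Ks i < Ls i)
    (hd : ∀ i j, i < j → Ls i ≤ Ks j) (hK : ∀ i, Ls i ≤ K) :
    Calc G (intervalOutputs R m n Ks Ls) (5 * K * μ) := by
  have h1 : Calc G (⋃ x ∈ Finset.range K, windowFns R m n 1 x)
      (K * (2 * ((m : ℝ) ^ 2 + m * n) * 2)) :=
    (Calc.biUnion_const (Finset.range K) _ fun x hx => calc_windowFns_one hμ.one_le hG.consts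
      hG.inputs x (hG.nat_mem _ (by simpa using hx))).mono subset_rfl subset_rfl (by simp)
  refine h1.trans ((Calc.biUnion Finset.univ (fun q => windowFns R m n (Ls q - Ks q) (Ks q))
    (fun q => ((Ls q - Ks q : ℕ) : ℝ) * μ) fun q _ => ?_).mono subset_rfl
    (intervalOutputs_subset (fun i => (h i).le) fun q => ?_) le_rfl) ?_
  · have := calc_windowFns_chain hμ
      (hG.union (O := ⋃ x ∈ Finset.range K, windowFns R m n 1 x)).consts 1 (Ks q) (Ls q - Ks q)
      fun j hj => ?_
    · simpa using this
    · have := hK q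
      refine Set.Subset.trans ?_ Set.subset_union_right
      exact windowFns_subset_biUnion (h := fun _ => 1) (x := fun x => x)
        (Finset.mem_range.2 (by omega))
  · exact Set.subset_biUnion_of_mem (u := fun q => windowFns R m n (Ls q - Ks q) (Ks q))
      (Finset.mem_coe.2 (Finset.mem_univ q))
  · rw [← Finset.sum_mul]
    have h2 : ((∑ q, (Ls q - Ks q) : ℕ) : ℝ) ≤ K := by
      exact_mod_cast sum_sub_le_of_disjoint Ks Ls hd hK
    push_cast at h2
    have h3 := hμ.size_le
    have h4 := hμ.one_le_cost
    have h5 := mul_le_mul_of_nonneg_right h2 (zero_le_one.trans h4)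
    have h6 := mul_le_mul_of_nonneg_left h3 (Nat.cast_nonneg K : (0 : ℝ) ≤ K)
    linarith

/-- All interval products, from the windows of length `2 ^ T` at the multiples of `2 ^ T` and those
of smaller lengths needed for multipoint evaluation. -/
theorem calc_intervalOutputs_blocks (hM : IsPolyMulCost R S M) (hμ : IsBlockMulCost R S m n μ)
    (hG : HasScalars S G B D) {T₁ g a r K : ℕ} (hT : 2 ^ T₁ < 2 ^ a)
    (hTB : 2 ^ (T₁ + g) ≤ B) (hTD : 2 ^ (T₁ + g) ≤ D)
    (h : ∀ t ≤ T₁, windowsAt R m n (2 ^ t) (2 ^ (T₁ + g)) (2 ^ t + 1) ⊆ G)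
    (hH : windowsAt R m n (2 ^ (T₁ + g)) (2 ^ (T₁ + g)) (17 * (2 ^ (T₁ + g) + 1)) ⊆ G)
    (hr : 2 * r * 2 ^ g ≤ 2 ^ a) (hKB : K < B * B) (hKH : K ≤ 16 * (2 ^ (T₁ + g) * 2 ^ (T₁ + g)))
    (Ks Ls : Fin r → ℕ) (hlt : ∀ i, Ks i < Ls i)
    (hd : ∀ i j, i < j → Ls i ≤ Ks j) (hK : ∀ i, Ls i ≤ K) :
    Calc G (intervalOutputs R m n Ks Ls)
      ((T₁ + 1) * (9 * ((m : ℝ) ^ 2 + m * n) * (a + 2) ^ 2 * M (2 ^ a) + 2 ^ a * μ) +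
        2 * 2 ^ a * μ + 16 * 2 ^ (T₁ + g) * μ) := by
  set H := 2 ^ (T₁ + g) with hHdef
  have hHpos : 1 ≤ H := Nat.one_le_two_pow
  choose l₁ k l₂ hsum hl₁ hl₂ hk using fun q : Fin r =>
    exists_block_decomposition hHpos (Ks q) (Ls q) (hlt q).le
  -- the initial and the final piece of the interval `q` have the numbers `2 q` and `2 q + 1`
  set x : ℕ → ℕ := fun j => if hj : j / 2 < r then
    (if j % 2 = 0 then Ks ⟨j / 2, hj⟩ else Ks ⟨j / 2, hj⟩ + l₁ ⟨j / 2, hj⟩ + k ⟨j / 2, hj⟩ * H)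
    else 0 with hx
  set l : ℕ → ℕ := fun j => if hj : j / 2 < r then
    (if j % 2 = 0 then l₁ ⟨j / 2, hj⟩ else l₂ ⟨j / 2, hj⟩) else 0 with hl
  have hxB : ∀ j, x j + l j < B * B := fun j => by
    simp only [hx, hl]
    split_ifs with h1 h2
    · have := hsum ⟨j / 2, h1⟩; have := hK ⟨j / 2, h1⟩; omega
    · have := hsum ⟨j / 2, h1⟩; have := hK ⟨j / 2, h1⟩; omega
    · omega
  have hlH : ∀ j, l j < 2 ^ (T₁ + g) := fun j => by
    simp only [hl]
    split_ifs
    · exact hl₁ _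
    · exact hl₂ _
    · exact hHpos
  have hT₁H : 2 ^ T₁ ≤ H := Nat.pow_le_pow_right (by norm_num) (Nat.le_add_right _ _)
  have hp := calc_windowFns_pieces hM hμ hG hT (hT₁H.trans hTB) (hT₁H.trans hTD) hHpos hTD h hr x l
    hxB hlH
  set W := ⋃ j ∈ Finset.range (2 * r), windowFns R m n (l j) (x j) with hW
  have hW₁ : ∀ q, windowFns R m n (l₁ q) (Ks q) ⊆ W := fun q => by
    have e1 : l (2 * q) = l₁ q := by simp [hl]
    have e2 : x (2 * q) = Ks q := by simp [hx]
    rw [← e1, ← e2]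
    exact windowFns_subset_biUnion (Finset.mem_range.2 (by omega))
  have hW₂ : ∀ q, windowFns R m n (l₂ q) (Ks q + l₁ q + k q * H) ⊆ W := fun q => by
    have h2 : (2 * (q : ℕ) + 1) / 2 = q := by omega
    have e1 : l (2 * q + 1) = l₂ q := by simp [hl, h2]
    have e2 : x (2 * q + 1) = Ks q + l₁ q + k q * H := by simp [hx, h2]
    rw [← e1, ← e2]
    exact windowFns_subset_biUnion (Finset.mem_range.2 (by omega))
  refine hp.trans ((Calc.biUnion Finset.univ (fun q => windowFns R m n (Ls q - Ks q) (Ks q))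
    (fun q => (k q : ℝ) * μ + μ + μ) fun q _ => ?_).mono subset_rfl
    (intervalOutputs_subset (fun i => (hlt i).le) fun q => ?_) le_rfl) ?_
  · have hc := calc_windowFns_chain hμ (hG.union (O := W)).consts H (Ks q + l₁ q) (k q)
      fun j hj => ?_
    · have hc₂ := hc.trans (calc_windowFns_add hμ (hG.union.union).consts
        (h := l₁ q) (k := k q * H) (x := Ks q)
        ((hW₁ q).trans (Set.subset_union_right.trans Set.subset_union_left))
        Set.subset_union_right) le_rfl
      have hc₃ := hc₂.trans (calc_windowFns_add hμ (hG.union.union).consts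
        (h := l₁ q + k q * H) (k := l₂ q) (x := Ks q) Set.subset_union_right
        (by
          rw [← add_assoc]
          exact (hW₂ q).trans (Set.subset_union_right.trans Set.subset_union_left))) le_rfl
      have e : l₁ q + k q * H + l₂ q = Ls q - Ks q := by have := hsum q; omega
      rwa [e] at hc₃
    · obtain ⟨i, hi, hib⟩ := hk q j hj
      rw [hi]
      refine (windowFns_subset_windowsAt ?_).trans (hH.trans Set.subset_union_left)
      have h1 := hib.trans ((hK q).trans hKH)
      have h2 : H * i ≤ H * (16 * H) := by linarith
      have := Nat.le_of_mul_le_mul_left h2 hHpos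
      omega
  · exact Set.subset_biUnion_of_mem (u := fun q => windowFns R m n (Ls q - Ks q) (Ks q))
      (Finset.mem_coe.2 (Finset.mem_univ q))
  · have h1 : (∑ q, k q) * H ≤ 16 * H * H := by
      rw [Finset.sum_mul]
      calc ∑ q, k q * H ≤ ∑ q, (Ls q - Ks q) := Finset.sum_le_sum fun q _ => by
            have := hsum q; omega
        _ ≤ K := sum_sub_le_of_disjoint Ks Ls hd hK
        _ ≤ _ := by rw [mul_assoc]; exact hKH
    have h2 : ((∑ q, k q : ℕ) : ℝ) ≤ 16 * 2 ^ (T₁ + g) := by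
      exact_mod_cast Nat.le_of_mul_le_mul_right h1 hHpos
    have h3 : ((2 * r * 2 ^ g : ℕ) : ℝ) ≤ 2 ^ a := by exact_mod_cast hr
    have h4 : ((2 * r : ℕ) : ℝ) ≤ 2 ^ a := by
      exact_mod_cast (Nat.le_mul_of_pos_right (2 * r) (by positivity)).trans hr
    have h5 := zero_le_one.trans hμ.one_le_cost
    have h6 := mul_le_mul_of_nonneg_right h2 h5
    have h7 := mul_le_mul_of_nonneg_right h3 h5
    have h8 := mul_le_mul_of_nonneg_right h4 h5
    have h9 := mul_le_mul_of_nonneg_left h8 (by positivity : (0 : ℝ) ≤ T₁ + 1)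
    push_cast at h6 h7 h8 h9 ⊢
    simp only [Finset.sum_add_distrib, ← Finset.sum_mul, Finset.sum_const, Finset.card_univ,
      Fintype.card_fin, nsmul_eq_mul]
    linarith

end Intervals

/-! ### Choice of parameters -/

section Final

variable {R : Type*} [CommRing R] {S : Set R} {m n : ℕ} {M : ℕ → ℝ} {μ : ℝ}

/-- The cost of the whole algorithm with blocks of length `2 ^ (s - 1)`, where the initial and
final pieces are cut into windows of length `2 ^ (s - 1 - g)`. -/
theorem calc_intervalOutputs (hM : IsPolyMulCost R S M) (hμ : IsBlockMulCost R S m n μ)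
    {s g r K : ℕ} (hg : g + 1 ≤ s) (hsg : 4 * (s * (s + 4) ^ 2) ≤ 2 ^ g)
    (hinv : ∀ j : ℕ, 2 ≤ j → j ≤ 2 ^ s + 1 → IsUnit (j : R) ∧ Ring.inverse (j : R) ∈ S)
    (hr : r * 2 ^ (2 * g) ≤ 2 ^ (s + 1)) (hK4 : K < 4 ^ (s + 1)) (Ks Ls : Fin r → ℕ)
    (hlt : ∀ i, Ks i < Ls i) (hd : ∀ i j, i < j → Ls i ≤ Ks j) (hK : ∀ i, Ls i ≤ K) :
    Calc ({f | ∃ c ∈ S, f = fun _ => c} ∪ blockInputs R m n) (intervalOutputs R m n Ks Ls)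
      (44 * μ * 2 ^ s + 361 * ((m : ℝ) ^ 2 + m * n) * M (2 ^ s)) := by
  obtain ⟨T₁, rfl⟩ : ∃ T₁, s = T₁ + g + 1 := ⟨s - (g + 1), by omega⟩
  set T := T₁ + g with hT
  set a := T₁ + 3 with ha
  have h2s : 2 ^ (T + 1) = 2 * 2 ^ T := pow_succ' 2 T
  have h2s' : 2 ^ (T + 1 + 1) = 2 * 2 ^ (T + 1) := pow_succ' 2 (T + 1)
  have hpos : 1 ≤ 2 ^ T := Nat.one_le_two_pow
  have h4 : 4 ^ (T + 1 + 1) = 2 ^ (T + 1 + 1) * 2 ^ (T + 1 + 1) := by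
    rw [← mul_pow]; norm_num
  obtain ⟨O, hO, hsc⟩ := calc_hasScalars (m := m) (n := n) hμ.one_mem (2 ^ (T + 1 + 1))
    (2 ^ (T + 1) + 1) hinv
  set G := {f | ∃ c ∈ S, f = fun _ => c} ∪ blockInputs R m n ∪ O
  have hlev := calc_windowsAt_levels hM hμ T hsc (by omega) (by omega)
  set V := ⋃ t ∈ Finset.range (T + 1), windowsAt R m n (2 ^ t) (2 ^ T) (2 ^ t + 1)
  have hV : ∀ t ≤ T, windowsAt R m n (2 ^ t) (2 ^ T) (2 ^ t + 1) ⊆ V := fun t ht =>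
    Set.subset_biUnion_of_mem (u := fun t => windowsAt R m n (2 ^ t) (2 ^ T) (2 ^ t + 1))
      (Finset.mem_coe.2 (Finset.mem_range.2 (Nat.lt_succ_of_le ht)))
  have hext := calc_windowsAt_extend hM hμ.one_le (hsc.union (O := V)) hpos (by omega) (by omega)
    ((hV T le_rfl).trans Set.subset_union_right)
  set W := windowsAt R m n (2 ^ T) (2 ^ T) (17 * (2 ^ T + 1))
  have hint := calc_intervalOutputs_blocks hM hμ ((hsc.union (O := V)).union (O := W))
    (T₁ := T₁) (g := g) (a := a) (r := r) (K := K)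
    (Nat.pow_lt_pow_right (by norm_num) (by omega)) (by rw [← hT]; omega) (by rw [← hT]; omega)
    (fun t ht => (hV t (by omega)).trans (Set.subset_union_right.trans Set.subset_union_left))
    Set.subset_union_right ?_ (by rw [← h4]; exact hK4) ?_ Ks Ls hlt hd hK
  · refine hO.trans (hlev.trans (hext.trans hint le_rfl) le_rfl) ?_
    have hμ1 := hμ.one_le_cost
    have hk1 : 1 ≤ (T + 1) * (T + 1 + 4) ^ 2 := Nat.mul_pos (Nat.succ_pos _) (by positivity)
    -- the logarithmic factors are absorbed by `2 ^ g`
    have hka : (T + 1) * (T + 1 + 4) ^ 2 * 2 ^ a ≤ 2 ^ (T + 1) := by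
      have e1 : 2 ^ (T + 1) = 2 ^ g * 2 ^ (T₁ + 1) := by rw [← pow_add]; congr 1; omega
      have e2 : 2 ^ a = 4 * 2 ^ (T₁ + 1) := by rw [ha, pow_add, pow_add]; ring
      rw [e1, e2]
      have := Nat.mul_le_mul_right (2 ^ (T₁ + 1)) hsg
      linarith
    have hMk : (((T + 1) * (T + 1 + 4) ^ 2 : ℕ) : ℝ) * M (2 ^ a) ≤ M (2 ^ (T + 1)) :=
      (hM.mul_le hk1 Nat.one_le_two_pow).trans (hM.mono (Nat.mul_pos hk1 (by positivity)) hka)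
    have hka' : (((T + 1) * (T + 1 + 4) ^ 2 : ℕ) : ℝ) * 2 ^ a ≤ 2 ^ (T + 1) := by exact_mod_cast hka
    have hT1 : (T₁ : ℝ) + 1 ≤ T + 1 := by
      rw [hT]; push_cast; linarith [(Nat.cast_nonneg g : (0 : ℝ) ≤ g)]
    have hak : ((T₁ : ℝ) + 1) * (a + 2) ^ 2 ≤ (((T + 1) * (T + 1 + 4) ^ 2 : ℕ) : ℝ) := by
      push_cast
      have : (a : ℝ) + 2 ≤ T + 1 + 4 := by rw [ha]; push_cast; linarith
      gcongr
    have hkT : (T₁ : ℝ) + 1 ≤ (((T + 1) * (T + 1 + 4) ^ 2 : ℕ) : ℝ) := by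
      refine le_trans ?_ hak
      refine le_mul_of_one_le_right (by positivity) ?_
      nlinarith [(Nat.cast_nonneg a : (0 : ℝ) ≤ a)]
    have he : (0 : ℝ) ≤ (m : ℝ) ^ 2 + m * n := by positivity
    have b1 : ((T₁ : ℝ) + 1) * (a + 2) ^ 2 * M (2 ^ a) ≤ M (2 ^ (T + 1)) :=
      (mul_le_mul_of_nonneg_right hak (hM.nonneg _)).trans hMk
    have b2 : ((T₁ : ℝ) + 1) * 2 ^ a ≤ 2 ^ (T + 1) :=
      (mul_le_mul_of_nonneg_right hkT (by positivity)).trans hka'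
    have b3 : (2 : ℝ) ^ a ≤ 2 ^ (T + 1) := by
      refine le_trans ?_ hka'
      exact le_mul_of_one_le_left (by positivity) (by exact_mod_cast hk1)
    have b4 : M (2 ^ T) ≤ M (2 ^ (T + 1)) := hM.mono hpos (by omega)
    have b5 : (1 : ℝ) ≤ 2 ^ T := one_le_pow₀ (by norm_num)
    have c1 := mul_le_mul_of_nonneg_left b1 he
    have c2 := mul_le_mul_of_nonneg_left b2 (zero_le_one.trans hμ1)
    have c3 := mul_le_mul_of_nonneg_left b3 (zero_le_one.trans hμ1)
    have c4 := mul_le_mul_of_nonneg_left b4 he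
    have c5 : (2 : ℝ) ^ T ≤ μ * 2 ^ T := le_mul_of_one_le_left (by positivity) hμ1
    rw [← h2s]
    have d1 : (2 : ℝ) ^ (T + 1) = 2 * 2 ^ T := pow_succ' 2 T
    have d2 : (2 : ℝ) ^ (T + 1 + 1) = 4 * 2 ^ T := by rw [pow_succ', pow_succ']; ring
    push_cast
    rw [d2]
    rw [d1] at c2 c3 ⊢
    linarith
  · have e1 : 2 * r * 2 ^ g * 2 ^ g ≤ 2 ^ a * 2 ^ g := by
      have e2 : 2 ^ a * 2 ^ g = 2 * 2 ^ (T + 1 + 1) := by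
        rw [← pow_add, ← pow_succ']; congr 1; omega
      have e3 : 2 * r * 2 ^ g * 2 ^ g = 2 * (r * 2 ^ (2 * g)) := by rw [two_mul g, pow_add]; ring
      rw [e2, e3]
      omega
    exact Nat.le_of_mul_le_mul_right e1 (by positivity)
  · rw [h4, h2s', h2s] at hK4
    rw [← hT]
    linarith

/-- A power of `s` is eventually smaller than the exponential `2 ^ ⌊ε s⌋`. -/
theorem exists_forall_le_two_pow_floor (ε : ℝ) (hε : 0 < ε) :
    ∃ s₀ : ℕ, ∀ s ≥ s₀, 4 * (s * (s + 4) ^ 2) ≤ 2 ^ ⌊ε * s⌋₊ := by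
  have h1 : (1 : ℝ) < 2 ^ ε := Real.one_lt_rpow (by norm_num) hε
  have h2 := (tendsto_pow_const_div_const_pow_of_one_lt 3 h1).eventually_lt_const
    (show (0 : ℝ) < 1 / 200 by norm_num)
  obtain ⟨s₀, hs₀⟩ := Filter.eventually_atTop.1 h2
  refine ⟨max s₀ 1, fun s hs => ?_⟩
  have hs1 : (1 : ℝ) ≤ s := by exact_mod_cast (le_max_right s₀ 1).trans hs
  have h3 := hs₀ s ((le_max_left _ _).trans hs)
  have h4 : (0 : ℝ) < ((2 : ℝ) ^ ε) ^ s := by positivity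
  rw [div_lt_iff₀ h4] at h3
  have h5 : ((2 : ℝ) ^ ε) ^ s ≤ 2 * 2 ^ ⌊ε * s⌋₊ := by
    rw [← Real.rpow_natCast, ← Real.rpow_mul (by norm_num), ← pow_succ', ← Real.rpow_natCast]
    refine Real.rpow_le_rpow_of_exponent_le (by norm_num) ?_
    push_cast
    exact (Nat.lt_floor_add_one _).le
  have h6 : (4 : ℝ) * (s * (s + 4) ^ 2) ≤ 100 * s ^ 3 := by
    have : ((s : ℝ) + 4) ^ 2 ≤ (5 * s) ^ 2 := by gcongr; linarith
    nlinarith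
  have h7 : ((4 * (s * (s + 4) ^ 2) : ℕ) : ℝ) ≤ ((2 ^ ⌊ε * s⌋₊ : ℕ) : ℝ) := by
    push_cast
    linarith
  exact_mod_cast h7

/-- The bound on the number of intervals, in terms of the parameter `g = ⌊ε s⌋`. -/
theorem mul_two_pow_le_of_lt_rpow {ε : ℝ} (hε0 : 0 < ε) (hε1 : ε < 1 / 2) {r K s : ℕ}
    (hK4 : K < 4 ^ (s + 1)) (hr : (r : ℝ) < (K : ℝ) ^ (1 / 2 - ε)) :
    r * 2 ^ (2 * ⌊ε * s⌋₊) ≤ 2 ^ (s + 1) := by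
  have h4 : (0 : ℝ) < 4 ^ (s + 1) := by positivity
  have hK : (K : ℝ) ≤ 4 ^ (s + 1) := by exact_mod_cast hK4.le
  have h1 : (r : ℝ) ≤ ((4 : ℝ) ^ (s + 1)) ^ (1 / 2 - ε) :=
    hr.le.trans (Real.rpow_le_rpow (Nat.cast_nonneg K) hK (by linarith))
  have hfl : (⌊ε * s⌋₊ : ℝ) ≤ ε * (s + 1) :=
    (Nat.floor_le (by positivity)).trans (by nlinarith)
  have h2 : (2 : ℝ) ^ (2 * ⌊ε * s⌋₊) ≤ ((4 : ℝ) ^ (s + 1)) ^ ε := by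
    rw [pow_mul, show (2 : ℝ) ^ 2 = 4 by norm_num, ← Real.rpow_natCast, ← Real.rpow_natCast,
      ← Real.rpow_mul (by norm_num)]
    refine Real.rpow_le_rpow_of_exponent_le (by norm_num) ?_
    push_cast
    linarith
  have h3 : ((4 : ℝ) ^ (s + 1)) ^ (1 / 2 - ε) * ((4 : ℝ) ^ (s + 1)) ^ ε = 2 ^ (s + 1) := by
    rw [← Real.rpow_add h4, show (1 / 2 - ε + ε) = 1 / 2 by ring, ← Real.sqrt_eq_rpow,
      show (4 : ℝ) = 2 ^ 2 by norm_num, ← pow_mul, mul_comm, pow_mul, Real.sqrt_sq (by positivity)]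
  have h5 : (r : ℝ) * 2 ^ (2 * ⌊ε * s⌋₊) ≤ 2 ^ (s + 1) := by
    rw [← h3]
    exact mul_le_mul h1 h2 (by positivity) (by positivity)
  exact_mod_cast h5

/-- Over the zero ring all quantities are equal to the constant `1`. -/
theorem Calc.of_subsingleton {Ω R : Type*} [CommRing R] [Subsingleton R] {S : Set R}
    (h1 : (1 : R) ∈ S) (I O : Set (Ω → R)) {t : ℝ} (ht : 0 ≤ t) :
    Calc ({f | ∃ c ∈ S, f = fun _ => c} ∪ I) O t :=
  .of_subset (fun _ _ => .inl ⟨1, h1, Subsingleton.elim _ _⟩) ht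

end Final

theorem mainTheorem3 (ε : ℝ) (hε0 : 0 < ε) (hε1 : ε < 1 / 2) :
    ∃ C : ℝ, 0 < C ∧
      ∀ (R : Type*) [CommRing R] (S : Set R) (MM : ℕ → ℕ → ℝ) (M : ℕ → ℝ),
        1 ∈ S →
        (∀ m n : ℕ, MatMulWithin R S m n (MM m n)) →
        (∀ d : ℕ, PolyMulWithin R S d (M d)) →
        (∀ a b : ℕ, 1 ≤ a → 1 ≤ b → M a + M b ≤ M (a + b)) →
        ∀ (m n r K : ℕ) (Ks Ls : Fin r → ℕ),
          1 ≤ m →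
          (∀ i, Ks i < Ls i) →
          (∀ i j, i < j → Ls i ≤ Ks j) →
          (∀ i, Ls i ≤ K) →
          (∀ j : ℕ, 2 ≤ j → j ≤ 2 ^ Nat.log 4 K + 1 →
            IsUnit (j : R) ∧ Ring.inverse (j : R) ∈ S) →
          (r : ℝ) < (K : ℝ) ^ (1 / 2 - ε) →
          IntervalProductsWithin R S m n Ks Ls
            (C * ((MM m m + MM m n) * √(K : ℝ)
              + ((m : ℝ) ^ 2 + (m : ℝ) * (n : ℝ)) * M (Nat.sqrt K))) := by
  obtain ⟨s₀, hs₀⟩ := exists_forall_le_two_pow_floor ε hε0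
  refine ⟨361 + 36 * 4 ^ max s₀ 2, by positivity, ?_⟩
  intro R _ S MM M h1 hMM hPM hsup m n r K Ks Ls hm hlt hd hK hinv hr
  set e : ℝ := (m : ℝ) ^ 2 + m * n with he
  have he0 : 0 ≤ e := by positivity
  have hA := Calc.nonneg (hMM m m)
  have hB := Calc.nonneg (hMM m n)
  have hMs := Calc.nonneg (hPM (Nat.sqrt K))
  have ht0 : 0 ≤ (MM m m + MM m n) * √(K : ℝ) + e * M (Nat.sqrt K) := by positivity
  have hC0 : (0 : ℝ) ≤ 36 * 4 ^ max s₀ 2 := by positivity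
  change Calc ({f | ∃ c ∈ S, f = fun _ => c} ∪ blockInputs R m n) (intervalOutputs R m n Ks Ls) _
  rcases subsingleton_or_nontrivial R with _ | _
  · exact Calc.of_subsingleton h1 _ _ (mul_nonneg (by positivity) ht0)
  have hM : IsPolyMulCost R S M := ⟨h1, hPM, hsup, (hPM 1).one_le⟩
  have hmn := (hMM m n).card_le hm
  have hmm := (hMM m m).card_le hm
  have hμ : IsBlockMulCost R S m n (4 * (MM m m + MM m n)) := by
    refine ⟨h1, hm, ?_, fun hG hX hY hXG hYG =>
      calc_entryFns_mul hm hmn (hMM m m) (hMM m n) hG _ _ hX hY hXG hYG⟩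
    rw [pow_two]
    linarith
  -- for `K = 0` the hypothesis on `r` reads `r < 0`
  have hKpos : 1 ≤ K := by
    rw [Nat.one_le_iff_ne_zero]
    rintro rfl
    rw [Nat.cast_zero, Real.zero_rpow (by linarith)] at hr
    exact absurd hr (not_lt.2 (Nat.cast_nonneg r))
  set s := Nat.log 4 K
  have hK4 : K < 4 ^ (s + 1) := Nat.lt_pow_succ_log_self (by norm_num) K
  have hsqrt1 : (1 : ℝ) ≤ √(K : ℝ) := Real.one_le_sqrt.2 (by exact_mod_cast hKpos)
  rcases le_or_gt (max s₀ 2) s with hs | hs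
  · have hfl : ⌊ε * s⌋₊ + 1 ≤ s := by
      have h2 : (2 : ℝ) ≤ s := by exact_mod_cast (le_max_right s₀ 2).trans hs
      have h3 : (⌊ε * s⌋₊ : ℝ) ≤ ε * s := Nat.floor_le (by positivity)
      have h4 : ((⌊ε * s⌋₊ + 1 : ℕ) : ℝ) ≤ s := by push_cast; nlinarith
      exact_mod_cast h4
    refine (calc_intervalOutputs hM hμ hfl (hs₀ s ((le_max_left _ _).trans hs)) hinv
      (mul_two_pow_le_of_lt_rpow hε0 hε1 hK4 hr) hK4 Ks Ls hlt hd hK).mono subset_rfl subset_rfl ?_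
    have h4s : 2 ^ s * 2 ^ s ≤ K := by
      rw [← mul_pow]
      exact Nat.pow_log_le_self 4 (by omega)
    have h2s : (2 : ℝ) ^ s ≤ √(K : ℝ) := by
      refine Real.le_sqrt_of_sq_le ?_
      rw [pow_two]
      exact_mod_cast h4s
    have hMle : M (2 ^ s) ≤ M (Nat.sqrt K) := hM.mono Nat.one_le_two_pow (Nat.le_sqrt.2 h4s)
    have c1 := mul_le_mul_of_nonneg_left h2s (add_nonneg hA hB)
    have c2 := mul_le_mul_of_nonneg_left hMle he0
    have c3 := mul_nonneg hC0 ht0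
    have c4 : 0 ≤ (MM m m + MM m n) * √(K : ℝ) := by positivity
    linarith
  -- `K` is bounded in terms of `ε`; the direct method needs no inverses
  · obtain ⟨O, hO, hsc⟩ := calc_hasScalars (m := m) (n := n) h1 K 0
      (fun j hj hj0 => absurd (hj.trans hj0) (by norm_num))
    refine hO.trans (calc_intervalOutputs_naive hμ hsc Ks Ls hlt hd hK) ?_
    have hK4' : (K : ℝ) ≤ 4 ^ max s₀ 2 := by
      exact_mod_cast hK4.le.trans (Nat.pow_le_pow_right (by norm_num) hs)
    have hm1 : (1 : ℝ) ≤ m := by exact_mod_cast hm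
    have hK1 : (1 : ℝ) ≤ K := by exact_mod_cast hKpos
    have hsum : 1 ≤ MM m m + MM m n := by nlinarith
    have c1 : (K : ℝ) * (MM m m + MM m n) ≤ 4 ^ max s₀ 2 * ((MM m m + MM m n) * √(K : ℝ)) :=
      mul_le_mul hK4' (le_mul_of_one_le_right (by linarith) hsqrt1) (by linarith) (by positivity)
    have c2 : (K : ℝ) ≤ K * (MM m m + MM m n) := le_mul_of_one_le_right (by linarith) hsum
    have c3 : 0 ≤ e * M (Nat.sqrt K) := by positivity
    have c4 := mul_nonneg hC0 c3
    push_cast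
    nlinarith
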